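/- Let $D\ge 0$, let $\mathbb R^{2D}$ be the doubled space with coordinates $X^M$, let $\partial_M=\partial/\partial X^M$, and raise and lower indices with the $O(D,D)$ metric $\eta=\begin{pmatrix}0&1\\1&0\end{pmatrix}$; write $(A^t)_M{}^N=A^N{}_M$ for transposition with respect to $\eta$. Fields and parameters have components in an algebra $\mathcal A$ (containing the constants) of smooth real functions on $\mathbb R^{2D}$ that is stable under all $\partial_M$ and satisfies the strong constraint $\partial^P\partial_P A=0$ for all $A\in\mathcal A$ (hence also $\partial^PA\,\partial_PB=0$ for $A,B\in\mathcal A$). All exponentials are understood order by order in the parameter, that is, as formal power series in a variable $\lambda$ for parameters $\Xi^M=\sum_{n\ge1}\lambda^n\Xi_n^M$. Put $$(\hat{\mathcal L}_\Xi V)_M=\Xi^K\partial_KV_M+(\partial_M\Xi^K-\partial^K\Xi_M)V_K,\qquad \mathcal G(\Xi)=e^{-\Xi^P\partial_P}\,e^{\hat{\mathcal L}_\Xi}.$$ With $X'^M=e^{-\Xi^P\partial_P}X^M$, $A_M{}^N(\Xi)=\partial_M(X^N-X'^N)$ and $B_M{}^N(\Xi)=\partial X^N/\partial X'^M$ (so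 $B=(1-A)^{-1}$), put $$\mathcal F(\Xi)=\tfrac12\left(B(B^t)^{-1}+(B^t)^{-1}B\right).$$ A parameter $\delta_n(\xi)$ is called quasi-trivial of order $n$ if $\delta_n^M(\xi)=\sum_i\rho_i(\xi)\,\partial^M\eta_i(\xi)$ is a finite sum in which $\rho_i(\xi)$ and $\eta_i(\xi)$ are universal polynomials in the components of $\xi$ and their iterated partial derivatives, homogeneous in $\xi$ of degrees adding up to $n$. **Theorem.** For every $D$ there are $\delta_n(\xi)$ and $\chi_n(\xi)$, $n\ge1$, quasi-trivial of order $n$, such that for every $\mathcal A$ as above and every parameter $\xi$ with components in $\mathcal A$ the following holds. Put $\delta(\lambda\xi)=\sum_{n\ge1}\lambda^n\delta_n(\xi)$, $\chi(\lambda\xi)=\sum_{n\ge1}\lambda^n\chi_n(\xi)$ and $\xi'(\lambda\xi)=\lambda\xi+\delta(\lambda\xi)$. 1. To all orders in $\xi$, $$\mathcal G(\xi'(\lambda\xi))=\mathcal F(\lambda\xi)\qquad\text{and}\qquad \mathcal G(\xi'(\lambda\xi))=\mathcal G(\lambda\xi)\,\mathcal G(\chi(\lambda\xi))$$ as operators on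 generalized vectors $V=(V_M)$ with components in $\mathcal A[[\lambda]]$, the matrix $\mathcal F$ acting by $(\mathcal FV)_M=\mathcal F_M{}^NV_N$. 2. Let $a_M{}^N=\partial_M\xi^N$, $(\Delta_n)_M{}^N=\partial_M\chi_n^N(\xi)$, $\chi_0=0$, and let $A_n$ be the coefficient of $\lambda^n$ in $A(\lambda\xi)$. Then for all $n\ge0$, with $\xi$ acting on matrices entrywise as $\xi^P\partial_P$, $$(n+1)(\Delta_{n+1}-\Delta_{n+1}^t)+(\xi+a)(\Delta_n-\Delta_n^t)+(\Delta_n-\Delta_n^t)a^t=\tfrac12\left(A_na^t-aA_n^t\right).$$ 3. Both $H=\mathcal F(\lambda\xi)$ and the matrix $H$ of $\mathcal G(\xi'(\lambda\xi))$ (whose columns are the images of the constant basis vectors) satisfy, with $A=A(\lambda\xi)$ and $B=B(\lambda\xi)$, $$\frac{dH}{d\lambda}=-\xi^P\partial_PH+H(a-a^t)+\tfrac12B\left(Aa^t-aA^t\right),\qquad H|_{\lambda=0}=1.$$ -/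

import Mathlib

open scoped ContDiff

noncomputable section

namespace DFT

/-! ## The doubled space and its functions -/

/-- The `2 D` values of an `O(D,D)` index. -/
abbrev Idx (D : ℕ) := Fin D ⊕ Fin D

/-- The doubled space `ℝ^{2D}` with its coordinates `X^M`. -/
abbrev Space (D : ℕ) := Idx D → ℝ

/-- Real functions on the doubled space. -/
abbrev Fn (D : ℕ) := Space D → ℝ

/-- Parameters `ξ = (ξ^M)`: vectors with upper index whose components are functions. -/
abbrev Param (D : ℕ) := Idx D → Fn D

/-- The index `M̄` paired with `M` by the `O(D,D)` metric `η = (0 1; 1 0)`. Raising or lowering an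
index with `η` is `v^M = v_{M̄}`, `v_M = v^{M̄}`. -/
def bar {D : ℕ} (M : Idx D) : Idx D := M.swap

/-- The partial derivative `∂_M f`; with the raised index, `∂^M f = pd (bar M) f`. -/
def pd {D : ℕ} (M : Idx D) (f : Fn D) : Fn D := fun x => fderiv ℝ f x (Pi.single M 1)

/-- An admissible algebra of fields: smooth functions, stable under products (it is a subalgebra)
and under partial derivatives, all of which satisfy the strong constraint `∂^P ∂_P A = 0`. -/
structure IsFieldAlgebra {D : ℕ} (𝒜 : Subalgebra ℝ (Fn D)) : Prop where
  smooth : ∀ A ∈ 𝒜, ContDiff ℝ ∞ A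
  pd_mem : ∀ A ∈ 𝒜, ∀ M, pd M A ∈ 𝒜
  strong_constraint : ∀ A ∈ 𝒜, ∑ P, pd (bar P) (pd P A) = 0

/-- Transposition with respect to `η`: `(Aᵗ)_M^N = A^N_M`. -/
def etaTr {D : ℕ} {R : Type*} (A : Matrix (Idx D) (Idx D) R) : Matrix (Idx D) (Idx D) R :=
  Matrix.of fun M N => A (bar N) (bar M)

/-- The matrix `a_M^N = ∂_M ξ^N` of a parameter. -/
def gradMat {D : ℕ} (ξ : Param D) : Matrix (Idx D) (Idx D) (Fn D) :=
  Matrix.of fun M N => pd M (ξ N)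

/-- The derivative `ξ^P ∂_P f` of a function along a parameter. -/
def along {D : ℕ} (ξ : Param D) (f : Fn D) : Fn D := ∑ P, ξ P * pd P f

/-! ## Terms of given order in the parameter, quasi-trivial parameters -/

/-- `IsDiffPoly n T`: the function `T(ξ)` is a universal polynomial expression, homogeneous of
degree `n`, in the components of `ξ` and their iterated partial derivatives. -/
inductive IsDiffPoly {D : ℕ} : ℕ → (Param D → Fn D) → Prop
  | comp (M : Idx D) : IsDiffPoly 1 (fun ξ => ξ M)
  | const (c : ℝ) : IsDiffPoly 0 (fun _ _ => c)
  | zero (n : ℕ) : IsDiffPoly n (fun _ => 0)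
  | add {n : ℕ} {S T : Param D → Fn D} (hS : IsDiffPoly n S) (hT : IsDiffPoly n T) :
      IsDiffPoly n (fun ξ => S ξ + T ξ)
  | mul {m n : ℕ} {S T : Param D → Fn D} (hS : IsDiffPoly m S) (hT : IsDiffPoly n T) :
      IsDiffPoly (m + n) (fun ξ => S ξ * T ξ)
  | pd {n : ℕ} {S : Param D → Fn D} (M : Idx D) (hS : IsDiffPoly n S) :
      IsDiffPoly n (fun ξ => DFT.pd M (S ξ))

/-- A quasi-trivial parameter of order `n` in `ξ`: a finite sum `∑ i, ρ_i(ξ) ∂^M η_i(ξ)` in which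
`ρ_i` and `η_i` are homogeneous differential polynomials in `ξ` whose degrees add up to `n`. -/
def IsQuasiTrivialOfOrder {D : ℕ} (n : ℕ) (δ : Param D → Param D) : Prop :=
  ∃ (m : ℕ) (p q : Fin m → ℕ) (ρ η : Fin m → Param D → Fn D),
    (∀ i, p i + q i = n ∧ IsDiffPoly (p i) (ρ i) ∧ IsDiffPoly (q i) (η i)) ∧
    ∀ ξ M, δ ξ M = ∑ i, ρ i ξ * pd (bar M) (η i ξ)

/-! ## Formal power series in `λ` with functions as coefficients -/

/-- Formal power series in `λ` whose coefficients are functions on the doubled space. -/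
abbrev FFn (D : ℕ) := PowerSeries (Fn D)

/-- Vectors of formal power series. -/
abbrev FVec (D : ℕ) := Idx D → FFn D

/-- Matrices of formal power series. -/
abbrev FMat (D : ℕ) := Matrix (Idx D) (Idx D) (FFn D)

/-- `∂_M` on formal power series, coefficient by coefficient. -/
def fpd {D : ℕ} (M : Idx D) (φ : FFn D) : FFn D := PowerSeries.mk fun n => pd M (φ.coeff n)

/-- The operator `Ξ^P ∂_P` acting on every component of a vector. -/
def transport {D : ℕ} (Ξ V : FVec D) : FVec D := fun M => ∑ P, Ξ P * fpd P (V M)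

/-- The generalized Lie derivative
`(L_Ξ V)_M = Ξ^K ∂_K V_M + (∂_M Ξ^K - ∂^K Ξ_M) V_K` of a generalized vector `V = (V_M)`. -/
def genLie {D : ℕ} (Ξ V : FVec D) : FVec D := fun M =>
  ∑ K, Ξ K * fpd K (V M) + ∑ K, (fpd M (Ξ K) - fpd (bar K) (Ξ (bar M))) * V K

/-- The exponential `e^T V = ∑ k, T^k V / k!` of an operator `T` that raises the order in `λ` by at
least one: then `T^k V` has no term of order `n` for `k > n`, and the sum is cut off there. -/
def fexp {D : ℕ} (T : FVec D → FVec D) (V : FVec D) : FVec D := fun M =>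
  PowerSeries.mk fun n =>
    ∑ k ∈ Finset.range (n + 1), ((k.factorial : ℝ)⁻¹) • ((T^[k] V) M).coeff n

/-! ## The two finite transformations
Here `Ξ` is a formal parameter without term of order zero in `λ`. -/

/-- `𝒢(Ξ) V = e^{-Ξ^P ∂_P} e^{L_Ξ} V`. -/
def genG {D : ℕ} (Ξ V : FVec D) : FVec D :=
  fexp (fun W => -transport Ξ W) (fexp (genLie Ξ) V)

/-- The matrix of `𝒢(Ξ)`: its columns are the images of the constant basis vectors. -/
def genGMat {D : ℕ} (Ξ : FVec D) : FMat D :=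
  Matrix.of fun M N => genG Ξ (Pi.single N 1) M

/-- The coordinates `X^M`. -/
def coord (D : ℕ) : FVec D := fun M => PowerSeries.C (fun x => x M)

/-- The transformed coordinates `X'^M = e^{-Ξ^P ∂_P} X^M`. -/
def newCoord {D : ℕ} (Ξ : FVec D) : FVec D := fexp (fun W => -transport Ξ W) (coord D)

/-- The matrix `A_M^N = ∂_M ζ^N`, where `ζ = X - X'`. -/
def matA {D : ℕ} (Ξ : FVec D) : FMat D :=
  Matrix.of fun M N => fpd M (coord D N - newCoord Ξ N)

/-- The matrix `B_M^N = ∂X^N / ∂X'^M`, inverse to the Jacobian matrix `∂X'^N / ∂X^M`. -/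
def matB {D : ℕ} (Ξ : FVec D) : FMat D :=
  (Matrix.of fun M N => fpd M (newCoord Ξ N))⁻¹

/-- `ℱ(Ξ) = ½ (B (Bᵗ)⁻¹ + (Bᵗ)⁻¹ B)`. -/
def genF {D : ℕ} (Ξ : FVec D) : FMat D :=
  (1 / 2 : ℝ) • (matB Ξ * (etaTr (matB Ξ))⁻¹ + (etaTr (matB Ξ))⁻¹ * matB Ξ)

/-! ## Rescaling `ξ` by `λ`, the equations in `λ` -/

/-- The formal parameter `λ ξ`. -/
def scaled {D : ℕ} (ξ : Param D) : FVec D := fun M => PowerSeries.X * PowerSeries.C (ξ M)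

/-- The formal parameter `δ(λξ) = ∑ n, λ^n δ_n(ξ)`. -/
def series {D : ℕ} (δ : ℕ → Param D → Param D) (ξ : Param D) : FVec D := fun M =>
  PowerSeries.mk fun n => δ n ξ M

/-- The antisymmetric part `Δ - Δᵗ` of the matrix `Δ_M^N = ∂_M χ^N`. -/
def skewGrad {D : ℕ} (χ : Param D) : Matrix (Idx D) (Idx D) (Fn D) :=
  gradMat χ - etaTr (gradMat χ)

/-- The recursion
`(n+1)(Δ_{n+1} - Δ_{n+1}ᵗ) + (ξ + a)(Δ_n - Δ_nᵗ) + (Δ_n - Δ_nᵗ) aᵗ = ½ (A_n aᵗ - a A_nᵗ)`,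
where `Δ_n` is the matrix of derivatives of `χ_n`, `A_n` is the coefficient of `λ^n` in `A(λξ)`, and
`ξ` acts on a matrix as `ξ^P ∂_P` on its entries. -/
def Recursion {D : ℕ} (ξ : Param D) (χ : ℕ → Param D) : Prop :=
  ∀ n : ℕ,
    ((n : ℝ) + 1) • skewGrad (χ (n + 1))
      + ((skewGrad (χ n)).map (along ξ) + gradMat ξ * skewGrad (χ n))
      + skewGrad (χ n) * etaTr (gradMat ξ)
    = (1 / 2 : ℝ) • ((matA (scaled ξ)).map (PowerSeries.coeff n) * etaTr (gradMat ξ)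
        - gradMat ξ * etaTr ((matA (scaled ξ)).map (PowerSeries.coeff n)))

/-- `H(λ)` solves the initial value problem
`dH/dλ = - ξ^P ∂_P H + H (a - aᵗ) + ½ B (A aᵗ - a Aᵗ)`, `H(0) = 1`,
where `A = A(λξ)`, `B = B(λξ)`. -/
def SolvesODE {D : ℕ} (ξ : Param D) (H : FMat D) : Prop :=
  let a : FMat D := (gradMat ξ).map PowerSeries.C
  H.map PowerSeries.constantCoeff = 1 ∧
  H.map (PowerSeries.derivative (Fn D))
    = -H.map (fun φ => ∑ P, PowerSeries.C (ξ P) * fpd P φ) + H * (a - etaTr a)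
      + (1 / 2 : ℝ) • (matB (scaled ξ) *
          (matA (scaled ξ) * etaTr a - a * etaTr (matA (scaled ξ))))

end DFT

end

noncomputable section

namespace DFT

open PowerSeries Finset

/-! ## Exponentials of formal power series over a noncommutative algebra -/

section Exponential

variable {B : Type*} [Ring B]

/-! By the strong constraint all gradients are mutually null: `∂^P f ∂_P g = 0`. For quasi-trivial
`χ`, transport along `χ` therefore vanishes, and `L_χ` is multiplication by the matrix `Δ - Δᵗ` of
the two-form `dχ`. This matrix takes values in the vectors annihilated by gradients (`annih`) and
kills those vectors, so `L_χ L_ψ = 0` for quasi-trivial `χ`, `ψ`, and `𝒢(χ) = 1 + Δ - Δᵗ`. Moreover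
`[L_ξ, L_χ] = L_{𝓛_ξ χ}` (`lieOp_commutator`), where `𝓛_ξ` is the ordinary Lie derivative of
one-forms, which preserves quasi-triviality.

Passage between `δ` and `χ`: since terms quadratic in `L_δ` vanish, `e^{λ L_ξ + L_δ} = e^{λ L_ξ} (1
+ L_χ)` with `χ = ((1 - e^{-λ 𝓛_ξ}) / (λ 𝓛_ξ)) δ` (`pexp_add`). This relation is triangular in the
order and can be solved for `δ`. As `δ` does not contribute to the transport term, `𝒢(λξ + δ) =
𝒢(λξ) (1 + Δ - Δᵗ) = 𝒢(λξ) 𝒢(χ)`.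

Choice of `χ`: `𝒢(λξ)` solves `G' = G L_ξ - (ξ^P ∂_P) G`, and `ℱ(λξ)` solves the same equation with
the additional source `½ B (A aᵗ - a Aᵗ)` (`serF_flow`). On `annih` the operators `𝒢(λξ)` and `B`
agree (`serG_sub_serB_apply`), so `𝒢(λξ) (1 + Δ - Δᵗ) = ℱ(λξ)` follows from `(Δ - Δᵗ)' + [L_ξ, Δ -
Δᵗ] = ½ (A aᵗ - a Aᵗ)` (`ChiRec.serG_mul`). The right side is the exterior derivative of `½ ζ^K ∂^M
ξ_K`, with `ζ = X - X'`, so it suffices to solve `χ' + 𝓛_ξ χ = ½ ζ^K ∂^M ξ_K`. This determines `χ`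
order by order, and its exterior derivative is the recursion of part 2.

The recursions for `χ_n` and `δ_n` make sense for every parameter and do not refer to the algebra;
on smooth parameters the Leibniz rule brings them to quasi-trivial form, which gives universality.
-/

lemma X_mul_C_pow (l : B) (k : ℕ) : ((X : PowerSeries B) * C l) ^ k = X ^ k * C (l ^ k) := by
  have h : Commute (X : PowerSeries B) (C l) := (commute_X _).symm
  rw [h.mul_pow, map_pow]

/-- The commutator with a constant. -/
def adC (l : B) (u : PowerSeries B) : PowerSeries B := C l * u - u * C l

lemma coeff_adC_iterate (l : B) (u : PowerSeries B) (j n : ℕ) :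
    coeff n ((adC l)^[j] u) = (fun b => l * b - b * l)^[j] (coeff n u) := by
  induction j with
  | zero => rfl
  | succ j ih =>
    rw [Function.iterate_succ_apply', Function.iterate_succ_apply', ← ih, adC, map_sub,
      coeff_C_mul, coeff_mul_C]

variable [Algebra ℝ B]

/-- The exponential of a formal power series without constant term. -/
def pexp (x : PowerSeries B) : PowerSeries B :=
  PowerSeries.mk fun n => ∑ k ∈ range (n + 1), ((k.factorial : ℝ)⁻¹) • coeff n (x ^ k)

/-- The formal derivative of a power series with noncommuting coefficients. -/
def dser (x : PowerSeries B) : PowerSeries B :=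
  PowerSeries.mk fun n => ((n : ℝ) + 1) • coeff (n + 1) x

lemma coeff_dser (x : PowerSeries B) (n : ℕ) :
    coeff n (dser x) = ((n : ℝ) + 1) • coeff (n + 1) x := by simp [dser]

lemma dser_add (x y : PowerSeries B) : dser (x + y) = dser x + dser y := by
  ext n; simp [coeff_dser]

lemma dser_smul (c : ℝ) (x : PowerSeries B) : dser (c • x) = c • dser x := by
  ext n; rw [coeff_dser, coeff_smul, coeff_smul, coeff_dser, smul_comm]

lemma dser_one : dser (1 : PowerSeries B) = 0 := by
  ext n; simp [coeff_dser, coeff_one]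

lemma dser_mul (x y : PowerSeries B) : dser (x * y) = dser x * y + x * dser y := by
  ext n
  have h1 : ((n : ℝ) + 1) • coeff (n + 1) (x * y)
      = ∑ p ∈ antidiagonal (n + 1), (p.1 : ℝ) • (coeff p.1 x * coeff p.2 y)
        + ∑ p ∈ antidiagonal (n + 1), (p.2 : ℝ) • (coeff p.1 x * coeff p.2 y) := by
    rw [coeff_mul, smul_sum, ← sum_add_distrib]
    refine sum_congr rfl fun p hp => ?_
    rw [← add_smul]
    congr 1
    have := mem_antidiagonal.1 hp
    exact_mod_cast this.symm
  rw [coeff_dser, h1, Nat.sum_antidiagonal_succ, Nat.sum_antidiagonal_succ', map_add, coeff_mul,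
    coeff_mul]
  simp [coeff_dser]

lemma coeff_pexp_X_mul_C (l : B) (n : ℕ) :
    coeff n (pexp (X * C l)) = ((n.factorial : ℝ)⁻¹) • l ^ n := by
  simp only [pexp, coeff_mk, X_mul_C_pow, coeff_X_pow_mul', coeff_C]
  rw [sum_eq_single n]
  · simp
  · intro k hk hkn
    have : k < n := by have := mem_range.1 hk; omega
    rw [if_pos this.le, if_neg (by omega), smul_zero]
  · simp

lemma pexp_zero : pexp (0 : PowerSeries B) = 1 := by
  ext n
  simp only [pexp, coeff_mk]
  rw [sum_eq_single 0]
  · simp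
  · intro k _ hk
    simp [zero_pow hk]
  · simp

/-- Applied to `L_χ` with `χ` quasi-trivial, this reduces `𝒢(χ)` to `1 + Δ - Δᵗ`. -/
lemma pexp_of_mul_self_eq_zero {u : PowerSeries B} (h : u * u = 0) (h0 : coeff 0 u = 0) :
    pexp u = 1 + u := by
  ext n
  simp only [pexp, coeff_mk, map_add]
  have hk : ∀ k, 2 ≤ k → u ^ k = 0 := fun k hk => by
    obtain ⟨m, rfl⟩ := Nat.exists_eq_add_of_le hk
    rw [pow_add, pow_two, h, zero_mul]
  rcases n with _ | n
  · rw [h0]; simp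
  · rw [sum_range_succ', sum_range_succ', sum_eq_zero]
    · simp [add_comm]
    · intro k _
      rw [hk _ (by omega)]; simp

lemma commute_C_pexp (l : B) : C l * pexp (X * C l) = pexp (X * C l) * C l := by
  ext n
  rw [coeff_C_mul, coeff_mul_C, coeff_pexp_X_mul_C, mul_smul_comm, smul_mul_assoc, ← pow_succ',
    ← pow_succ]

lemma dser_pexp (l : B) : dser (pexp (X * C l)) = C l * pexp (X * C l) := by
  ext n
  rw [coeff_dser, coeff_C_mul, coeff_pexp_X_mul_C, coeff_pexp_X_mul_C, mul_smul_comm, ← pow_succ',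
    smul_smul]
  congr 1
  rw [Nat.factorial_succ]
  push_cast
  have : (n.factorial : ℝ) ≠ 0 := by positivity
  field_simp

omit [Algebra ℝ B] in
lemma coeff_zero_mul (x y : PowerSeries B) : coeff 0 (x * y) = coeff 0 x * coeff 0 y := by
  simp [coeff_mul]

lemma coeff_zero_pexp_X_mul_C (l : B) : coeff 0 (pexp (X * C l)) = 1 := by
  rw [coeff_pexp_X_mul_C]; simp

/-- With `t` the transport term and `l` the generalized Lie derivative, this is the differential
equation of `𝒢(λξ)`. -/
lemma dser_pexp_mul_pexp (t l : B) :
    dser (pexp (X * C (-t)) * pexp (X * C l))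
      = pexp (X * C (-t)) * pexp (X * C l) * C l - C t * (pexp (X * C (-t)) * pexp (X * C l)) := by
  rw [dser_mul, dser_pexp, dser_pexp, commute_C_pexp l, map_neg]
  noncomm_ring

/-- A formal linear differential equation has no nonzero solution with zero initial value. -/
lemma eq_zero_of_dser {y : PowerSeries B} {S T : B} (h0 : coeff 0 y = 0)
    (h : dser y = y * C T - C S * y) : y = 0 := by
  ext n
  rw [map_zero]
  induction n with
  | zero => exact h0
  | succ n ih =>
    have := congrArg (coeff n) h
    rw [coeff_dser, map_sub, coeff_mul_C, coeff_C_mul, ih, zero_mul, mul_zero, sub_zero] at this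
    exact (smul_eq_zero.1 this).resolve_left (by positivity)

/-- Variation of constants: the commutator with `t` in `hw` compensates the right multiplication by
`t` in `hg`, so `g * (1 + w)` obeys the equation of `f` with source `g * p = b * p`. Uniqueness
concludes. -/
lemma eq_of_dser_eq {g w f b p : PowerSeries B} {s t : B} (h0 : coeff 0 (g * (1 + w) - f) = 0)
    (hg : dser g = g * C t - C s * g) (hw : dser w = p - C t * w + w * C t)
    (hf : dser f = f * C t + b * p - C s * f) (hp : g * p = b * p) : g * (1 + w) = f := by
  rw [← sub_eq_zero]
  refine eq_zero_of_dser (S := s) (T := t) h0 ?_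
  rw [sub_eq_add_neg, dser_add, ← neg_one_smul ℝ f, dser_smul, dser_mul, dser_add, dser_one, hg, hw,
    hf, ← hp, neg_one_smul, neg_one_smul]
  noncomm_ring

/-- The coefficients `(-1)^i / (i+1)!` of `(1 - e^{-x}) / x`. -/
def adCoeff (i : ℕ) : ℝ := (-1) ^ i * ((i + 1).factorial : ℝ)⁻¹

lemma adCoeff_zero : adCoeff 0 = 1 := by simp [adCoeff]

lemma adCoeff_succ (i : ℕ) : ((i : ℝ) + 2) * adCoeff (i + 1) = -adCoeff i := by
  have : ((i + 1).factorial : ℝ) ≠ 0 := by positivity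
  rw [adCoeff, adCoeff, Nat.factorial_succ (i + 1)]
  push_cast
  field_simp
  ring

/-- The expansion of `e^{-λ l} e^{λ l + u}` when the terms quadratic in `u` vanish. -/
def dyson (l : B) (u : PowerSeries B) : ℕ → PowerSeries B
  | 0 => 1
  | j + 1 => adCoeff j • (X ^ j * (adC l)^[j] u)

/-- Right multiplication by `λ l + u` is left multiplication by `λ l` plus a step `j ↦ j + 1`. The
two operations play the roles of commuting summands, which makes the binomial expansion of `(λ l +
u)^k` possible. -/
lemma dyson_mul (l : B) (u : PowerSeries B) (h : ∀ j, (adC l)^[j] u * u = 0) (j : ℕ) :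
    dyson l u j * (X * C l + u) = X * C l * dyson l u j + ((j : ℝ) + 1) • dyson l u (j + 1) := by
  rcases j with _ | j
  · simp [dyson, adCoeff_zero]
  · have h2 : ((j : ℝ) + 1 + 1) • (adCoeff (j + 1) • (X ^ (j + 1) * (adC l)^[j + 1] u))
        = -(adCoeff j • (X ^ (j + 1) * (C l * (adC l)^[j] u - (adC l)^[j] u * C l))) := by
      rw [smul_smul, show (j : ℝ) + 1 + 1 = j + 2 by ring, adCoeff_succ, neg_smul,
        Function.iterate_succ_apply']
      rfl
    have h3 : X * C l * (X ^ j * (adC l)^[j] u) = X ^ (j + 1) * (C l * (adC l)^[j] u) := by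
      rw [mul_assoc, ← mul_assoc (C l), (commute_X_pow (C l) j).eq, pow_succ']
      simp only [mul_assoc]
    have h4 : X ^ j * (adC l)^[j] u * (X * C l) = X ^ (j + 1) * ((adC l)^[j] u * C l) := by
      rw [← mul_assoc, mul_assoc (X ^ j), (commute_X ((adC l)^[j] u)).eq, pow_succ]
      simp only [mul_assoc]
    simp only [dyson]
    push_cast
    rw [h2, mul_add, smul_mul_assoc, smul_mul_assoc, mul_assoc (X ^ j) _ u, h j, mul_zero,
      smul_zero, add_zero, h4, mul_smul_comm, h3, mul_sub, smul_sub]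
    abel

lemma pow_add_eq_sum_dyson (l : B) (u : PowerSeries B) (h : ∀ j, (adC l)^[j] u * u = 0) (k : ℕ) :
    ((k.factorial : ℝ)⁻¹) • (X * C l + u) ^ k
      = ∑ p ∈ antidiagonal k, ((p.1.factorial : ℝ)⁻¹) • ((X * C l) ^ p.1 * dyson l u p.2) := by
  induction k with
  | zero => simp [dyson]
  | succ k ih =>
    have hk : ((k : ℝ) + 1) ≠ 0 := by positivity
    have e1 : ((k + 1).factorial : ℝ)⁻¹ • (X * C l + u) ^ (k + 1)
        = ((k : ℝ) + 1)⁻¹ • (((k.factorial : ℝ)⁻¹ • (X * C l + u) ^ k) * (X * C l + u)) := by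
      rw [smul_mul_assoc, ← pow_succ, smul_smul, Nat.factorial_succ]
      push_cast
      rw [mul_inv]
    rw [e1, ih, sum_mul, inv_smul_eq_iff₀ hk]
    set f : ℕ × ℕ → PowerSeries B := fun p =>
      ((p.1.factorial : ℝ)⁻¹) • ((X * C l) ^ p.1 * dyson l u p.2) with hf
    have e2 : ((k : ℝ) + 1) • ∑ p ∈ antidiagonal (k + 1), f p
        = ∑ p ∈ antidiagonal (k + 1), (p.1 : ℝ) • f p
          + ∑ p ∈ antidiagonal (k + 1), (p.2 : ℝ) • f p := by
      rw [smul_sum, ← sum_add_distrib]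
      refine sum_congr rfl fun p hp => ?_
      rw [← add_smul]
      congr 1
      have := mem_antidiagonal.1 hp
      exact_mod_cast this.symm
    rw [e2, Nat.sum_antidiagonal_succ, Nat.sum_antidiagonal_succ']
    simp only [Nat.cast_zero, zero_smul, zero_add]
    rw [← sum_add_distrib]
    refine sum_congr rfl fun p _ => ?_
    rw [smul_mul_assoc, mul_assoc, dyson_mul l u h, mul_add, smul_add, hf]
    congr 1
    · simp only
      rw [smul_smul, Nat.factorial_succ, pow_succ, mul_assoc ((X * C l) ^ p.1)]
      congr 1
      have : ((p.1 : ℝ) + 1) ≠ 0 := by positivity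
      push_cast
      field_simp
    · simp only
      rw [mul_smul_comm, smul_comm]
      push_cast
      rfl

/-- `e^{λ l + u} = e^{λ l} (1 + w)` when the terms quadratic in `u` vanish, where `w` is obtained
from `u` by the operator `(1 - e^{-λ ad l}) / (λ ad l)`. -/
lemma pexp_add (l : B) (u w : PowerSeries B) (h : ∀ j, (adC l)^[j] u * u = 0)
    (h0 : coeff 0 u = 0)
    (hw : ∀ n, coeff n w = ∑ j ∈ range (n + 1), adCoeff j • coeff (n - j) ((adC l)^[j] u)) :
    pexp (X * C l + u) = pexp (X * C l) * (1 + w) := by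
  have hd : ∀ m, coeff m (1 + w) = ∑ j ∈ range (m + 1), coeff m (dyson l u j) := by
    intro m
    rw [map_add, hw, sum_range_succ' (fun j => coeff m (dyson l u j)) m, add_comm]
    simp only [dyson]
    congr 1
    -- The sum for `w` has one term more than the expansion: its last one, `j = m`, involves only
    -- the constant term of `u`, which is zero.
    rw [sum_range_succ, Nat.sub_self, coeff_adC_iterate l u m 0, h0]
    have hz : (fun b => l * b - b * l)^[m] (0 : B) = 0 := by
      induction m with
      | zero => rfl
      | succ m ih => rw [Function.iterate_succ_apply]; simpa using ih
    rw [hz, smul_zero, add_zero]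
    refine sum_congr rfl fun j hj => ?_
    rw [coeff_smul, coeff_X_pow_mul', if_pos (mem_range.1 hj).le]
  ext n
  rw [pexp, coeff_mk, coeff_mul]
  simp only [coeff_pexp_X_mul_C, ← coeff_smul, pow_add_eq_sum_dyson l u h, map_sum]
  have hterm : ∀ i j, i ≤ n → coeff n (((i.factorial : ℝ)⁻¹) • ((X * C l) ^ i * dyson l u j))
      = (((i.factorial : ℝ)⁻¹) • l ^ i) * coeff (n - i) (dyson l u j) := by
    intro i j hi
    rw [coeff_smul, X_mul_C_pow, mul_assoc, coeff_X_pow_mul', if_pos hi, coeff_C_mul,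
      smul_mul_assoc]
  rw [Nat.sum_antidiagonal_eq_sum_range_succ_mk]
  simp only [hd, mul_sum]
  rw [sum_sigma', sum_sigma']
  -- Both sides run over the pairs `(i, j)` with `i + j ≤ n`, grouped by `k = i + j` on the left.
  refine sum_bij' (fun a _ => ⟨a.2.1, a.2.2⟩) (fun a _ => ⟨a.1 + a.2, (a.1, a.2)⟩) ?_ ?_ ?_ ?_ ?_
  · rintro ⟨k, i, j⟩ ha
    simp only [mem_sigma, mem_range, HasAntidiagonal.mem_antidiagonal] at ha ⊢
    omega
  · rintro ⟨i, j⟩ ha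
    simp only [mem_sigma, mem_range, HasAntidiagonal.mem_antidiagonal] at ha ⊢
    exact ⟨by omega, trivial⟩
  · rintro ⟨k, i, j⟩ ha
    simp only [mem_sigma, mem_range, HasAntidiagonal.mem_antidiagonal] at ha ⊢
    obtain ⟨_, rfl⟩ := ha
    rfl
  · rintro ⟨i, j⟩ ha
    rfl
  · rintro ⟨k, i, j⟩ ha
    simp only [mem_sigma, mem_range, HasAntidiagonal.mem_antidiagonal] at ha ⊢
    exact hterm i j (by omega)

end Exponential

/-! ## Transposition with respect to `η` -/

lemma bar_bar {D : ℕ} (M : Idx D) : bar (bar M) = M := Sum.swap_swap M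

/-- The involution `M ↦ M̄` as an equivalence. -/
def barEquiv (D : ℕ) : Idx D ≃ Idx D := ⟨bar, bar, bar_bar, bar_bar⟩

lemma sum_bar {D : ℕ} {S : Type*} [AddCommMonoid S] (f : Idx D → S) :
    ∑ P, f (bar P) = ∑ P, f P := (barEquiv D).sum_comp f

section EtaTr

variable {D : ℕ} {S : Type*}

lemma etaTr_apply (A : Matrix (Idx D) (Idx D) S) (M N : Idx D) :
    etaTr A M N = A (bar N) (bar M) := rfl

lemma etaTr_sub [Sub S] (A B : Matrix (Idx D) (Idx D) S) : etaTr (A - B) = etaTr A - etaTr B := rfl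

lemma etaTr_map {S' : Type*} (f : S → S') (A : Matrix (Idx D) (Idx D) S) :
    etaTr (A.map f) = (etaTr A).map f := rfl

lemma etaTr_mul [CommSemiring S] (A B : Matrix (Idx D) (Idx D) S) :
    etaTr (A * B) = etaTr B * etaTr A := by
  ext M N
  simp only [etaTr_apply, Matrix.mul_apply]
  rw [← sum_bar]
  exact sum_congr rfl fun P _ => mul_comm _ _

lemma etaTr_one [Zero S] [One S] : etaTr (1 : Matrix (Idx D) (Idx D) S) = 1 := by
  ext M N
  rw [etaTr_apply, Matrix.one_apply, Matrix.one_apply]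
  have : bar N = bar M ↔ M = N :=
    ⟨fun h => by rw [← bar_bar M, ← h, bar_bar], fun h => by rw [h]⟩
  simp only [this]

end EtaTr

/-! ## Algebras with commuting derivations -/

section Differential

variable {D : ℕ} {R : Type*} [CommRing R] [Algebra ℝ R] (d : Idx D → Derivation ℝ R R)

/-- The derivation `ξ^P ∂_P`. -/
def dAlong (ξ : Idx D → R) : Derivation ℝ R R := ∑ P, ξ P • d P

lemma dAlong_apply (ξ : Idx D → R) (f : R) : dAlong d ξ f = ∑ P, ξ P * d P f := by
  change Derivation.coeFnAddMonoidHom (∑ P, ξ P • d P) f = _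
  rw [map_sum, Finset.sum_apply]
  rfl

/-- The matrix `∂_M ξ^N`. -/
def dGrad (ξ : Idx D → R) : Matrix (Idx D) (Idx D) R := Matrix.of fun M N => d M (ξ N)

lemma dGrad_apply (ξ : Idx D → R) (M N : Idx D) : dGrad d ξ M N = d M (ξ N) := rfl

/-- The matrix `∂_M χ^N - ∂^N χ_M`. -/
def dSkew (χ : Idx D → R) : Matrix (Idx D) (Idx D) R := dGrad d χ - etaTr (dGrad d χ)

lemma dSkew_apply (χ : Idx D → R) (M N : Idx D) :
    dSkew d χ M N = d M (χ N) - d (bar N) (χ (bar M)) := rfl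

lemma dSkew_add (χ ψ : Idx D → R) : dSkew d (χ + ψ) = dSkew d χ + dSkew d ψ := by
  ext M N
  simp only [dSkew_apply, Matrix.add_apply, Pi.add_apply, map_add]
  ring

lemma dSkew_smul (c : ℝ) (χ : Idx D → R) : dSkew d (c • χ) = c • dSkew d χ := by
  ext M N
  simp only [dSkew_apply, Matrix.smul_apply, Pi.smul_apply, Derivation.map_smul, smul_sub]

lemma dSkew_zero : dSkew d (0 : Idx D → R) = 0 := by
  ext M N; simp [dSkew_apply]

/-- The Lie derivative of a one-form, with its index raised:
`(𝓛_ξ χ)^M = ξ^P ∂_P χ^M + ∂^M ξ^P χ_P`. -/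
def dLie (ξ : Idx D → R) : Module.End ℝ (Idx D → R) where
  toFun χ M := dAlong d ξ (χ M) + ∑ P, d (bar M) (ξ P) * χ (bar P)
  map_add' χ ψ := by
    ext M
    simp only [Pi.add_apply, map_add, mul_add, sum_add_distrib]
    ring
  map_smul' c χ := by
    ext M
    simp only [Pi.smul_apply, Derivation.map_smul, mul_smul_comm, smul_add, smul_sum, RingHom.id_apply]

lemma dLie_apply (ξ χ : Idx D → R) (M : Idx D) :
    dLie d ξ χ M = dAlong d ξ (χ M) + ∑ P, d (bar M) (ξ P) * χ (bar P) := rfl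

variable {d}

/-- The exterior derivative commutes with Lie derivatives. -/
lemma dSkew_dLie (hc : ∀ M N f, d M (d N f) = d N (d M f)) (ξ χ : Idx D → R) :
    dSkew d (dLie d ξ χ)
      = (dSkew d χ).map (dAlong d ξ) + dGrad d ξ * dSkew d χ
        + dSkew d χ * etaTr (dGrad d ξ) := by
  ext M N
  have h3 : (dSkew d χ * etaTr (dGrad d ξ)) M N
      = ∑ P, (d M (χ (bar P)) - d P (χ (bar M))) * d (bar N) (ξ P) := by
    rw [Matrix.mul_apply, ← sum_bar]
    simp only [dSkew_apply, etaTr_apply, dGrad_apply, bar_bar]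
  rw [Matrix.add_apply, Matrix.add_apply, h3, Matrix.mul_apply, Matrix.map_apply]
  simp only [dSkew_apply, dLie_apply, dGrad_apply, dAlong_apply, map_add, map_sum, map_sub,
    Derivation.leibniz, smul_eq_mul, bar_bar, ← sum_add_distrib, ← sum_sub_distrib]
  refine sum_congr rfl fun P _ => ?_
  rw [hc P M, hc P (bar N), hc (bar N) M]
  ring

/-- Leibniz rule for the one-form `ρ dη`, together with `𝓛_ξ dη = d(ξ^P ∂_P η)`. No strong
constraint is needed. -/
lemma dLie_mul_grad (hc : ∀ M N f, d M (d N f) = d N (d M f)) (ξ : Idx D → R) (ρ η : R) :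
    dLie d ξ (fun M => ρ * d (bar M) η)
      = (fun M => dAlong d ξ ρ * d (bar M) η) + fun M => ρ * d (bar M) (dAlong d ξ η) := by
  ext M
  simp only [dLie_apply, Pi.add_apply, dAlong_apply, map_sum, Derivation.leibniz, smul_eq_mul,
    bar_bar, mul_sum, sum_mul, ← sum_add_distrib]
  refine sum_congr rfl fun P _ => ?_
  rw [hc P (bar M)]
  ring

variable (d) in
/-- Quasi-trivial vectors: the span of the vectors `ρ ∂^M η`. -/
def quasi : Submodule ℝ (Idx D → R) :=
  Submodule.span ℝ {v | ∃ ρ η : R, v = fun M => ρ * d (bar M) η}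

lemma dLie_mem_quasi (hc : ∀ M N f, d M (d N f) = d N (d M f)) (ξ : Idx D → R)
    {χ : Idx D → R} (hχ : χ ∈ quasi d) : dLie d ξ χ ∈ quasi d := by
  refine Submodule.span_induction (p := fun χ _ => dLie d ξ χ ∈ quasi d) ?_ ?_ ?_ ?_ hχ
  · rintro _ ⟨ρ, η, rfl⟩
    rw [dLie_mul_grad hc]
    exact add_mem (Submodule.subset_span ⟨_, _, rfl⟩) (Submodule.subset_span ⟨_, _, rfl⟩)
  · simp
  · intro x y _ _ hx hy
    rw [map_add]; exact add_mem hx hy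
  · intro c x _ hx
    rw [map_smul]; exact Submodule.smul_mem _ _ hx

variable (d) in
/-- Covectors annihilated by all gradients: `∂^M f v_M = 0` for every function `f`. -/
def annih : Submodule ℝ (Idx D → R) where
  carrier := {v | ∀ f, ∑ M, d (bar M) f * v M = 0}
  zero_mem' f := by simp
  add_mem' {v w} hv hw f := by
    simp only [Pi.add_apply, mul_add, sum_add_distrib, hv f, hw f, add_zero]
  smul_mem' c v hv f := by
    simp only [Pi.smul_apply, mul_smul_comm, ← smul_sum, hv f, smul_zero]

lemma mem_annih {v : Idx D → R} : v ∈ annih d ↔ ∀ f, ∑ M, d (bar M) f * v M = 0 := Iff.rfl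

lemma grad_mem_annih (hs : ∀ f g, ∑ P, d (bar P) f * d P g = 0) (g : R) :
    (fun M => d M g) ∈ annih d := fun f => hs f g

lemma sum_smul_mem_annih {ι : Type*} (s : Finset ι) (c : ι → R) (v : ι → Idx D → R)
    (hv : ∀ i ∈ s, v i ∈ annih d) : (fun M => ∑ i ∈ s, c i * v i M) ∈ annih d := by
  intro f
  simp only [mul_sum]
  rw [sum_comm]
  refine sum_eq_zero fun i hi => ?_
  have := mem_annih.1 (hv i hi) f
  rw [← mul_zero (c i), ← this, mul_sum]
  exact sum_congr rfl fun M _ => by ring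

lemma dGrad_mulVec_mem_annih (hs : ∀ f g, ∑ P, d (bar P) f * d P g = 0) (ξ v : Idx D → R) :
    (dGrad d ξ).mulVec v ∈ annih d := by
  have := sum_smul_mem_annih univ v (fun K M => d M (ξ K)) fun K _ => grad_mem_annih hs (ξ K)
  convert this using 1
  ext M
  simp only [Matrix.mulVec, dotProduct, dGrad_apply]
  exact sum_congr rfl fun K _ => mul_comm _ _

lemma etaTr_dGrad_mulVec (ξ : Idx D → R) {v : Idx D → R} (hv : v ∈ annih d) :
    (etaTr (dGrad d ξ)).mulVec v = 0 := by
  ext M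
  exact hv (ξ (bar M))

/-- This is `d(ρ dη) = dρ ∧ dη`: the second derivatives of `η` cancel, and both indices are carried
by gradients. -/
lemma dSkew_mul_grad (hc : ∀ M N f, d M (d N f) = d N (d M f)) (ρ η : R) (M N : Idx D) :
    dSkew d (fun M => ρ * d (bar M) η) M N = d M ρ * d (bar N) η - d (bar N) ρ * d M η := by
  simp only [dSkew_apply, Derivation.leibniz, smul_eq_mul, bar_bar]
  rw [hc M]
  ring

lemma dSkew_mulVec_mem_annih (hc : ∀ M N f, d M (d N f) = d N (d M f))
    (hs : ∀ f g, ∑ P, d (bar P) f * d P g = 0) {χ : Idx D → R} (hχ : χ ∈ quasi d)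
    (v : Idx D → R) : (dSkew d χ).mulVec v ∈ annih d := by
  refine Submodule.span_induction (p := fun χ _ => (dSkew d χ).mulVec v ∈ annih d) ?_ ?_ ?_ ?_ hχ
  · rintro _ ⟨ρ, η, rfl⟩
    have h1 := sum_smul_mem_annih univ (fun N => d (bar N) η * v N) (fun _ M => d M ρ)
      fun _ _ => grad_mem_annih hs ρ
    have h2 := sum_smul_mem_annih univ (fun N => d (bar N) ρ * v N) (fun _ M => d M η)
      fun _ _ => grad_mem_annih hs η
    convert sub_mem h1 h2 using 1
    ext M
    simp only [Matrix.mulVec, dotProduct, dSkew_mul_grad hc, Pi.sub_apply, ← sum_sub_distrib]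
    exact sum_congr rfl fun K _ => by ring
  · rw [dSkew_zero, Matrix.zero_mulVec]; exact zero_mem _
  · intro x y _ _ hx hy
    rw [dSkew_add, Matrix.add_mulVec]; exact add_mem hx hy
  · intro c x _ hx
    rw [dSkew_smul, Matrix.smul_mulVec]; exact Submodule.smul_mem _ _ hx

lemma dSkew_mulVec_eq_zero (hc : ∀ M N f, d M (d N f) = d N (d M f)) {χ : Idx D → R}
    (hχ : χ ∈ quasi d) {v : Idx D → R} (hv : v ∈ annih d) : (dSkew d χ).mulVec v = 0 := by
  refine Submodule.span_induction (p := fun χ _ => (dSkew d χ).mulVec v = 0) ?_ ?_ ?_ ?_ hχ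
  · rintro _ ⟨ρ, η, rfl⟩
    ext M
    simp only [Matrix.mulVec, dotProduct, dSkew_mul_grad hc, sub_mul, sum_sub_distrib, mul_assoc,
      mul_left_comm _ (d M η), ← mul_sum, mem_annih.1 hv η, Pi.zero_apply, mem_annih.1 hv ρ,
      mul_zero, sub_zero]
  · rw [dSkew_zero, Matrix.zero_mulVec]
  · intro x y _ _ hx hy
    rw [dSkew_add, Matrix.add_mulVec, hx, hy, add_zero]
  · intro c x _ hx
    rw [dSkew_smul, Matrix.smul_mulVec, hx, smul_zero]

lemma dAlong_eq_zero (hs : ∀ f g, ∑ P, d (bar P) f * d P g = 0) {χ : Idx D → R}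
    (hχ : χ ∈ quasi d) (f : R) : dAlong d χ f = 0 := by
  rw [dAlong_apply]
  refine Submodule.span_induction (p := fun χ _ => ∑ P, χ P * d P f = 0) ?_ ?_ ?_ ?_ hχ
  · rintro _ ⟨ρ, η, rfl⟩
    simp only [mul_assoc, ← mul_sum, hs, mul_zero]
  · simp
  · intro x y _ _ hx hy
    simp only [Pi.add_apply, add_mul, sum_add_distrib, hx, hy, add_zero]
  · intro c x _ hx
    simp only [Pi.smul_apply, smul_mul_assoc, ← smul_sum, hx, smul_zero]

/-! ### Operators on vectors -/

/-- The operator of multiplication by a matrix. -/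
def matOp : Matrix (Idx D) (Idx D) R →+* Module.End ℝ (Idx D → R) where
  toFun A := A.mulVecLin.restrictScalars ℝ
  map_one' := LinearMap.ext fun v => Matrix.one_mulVec v
  map_mul' A B := LinearMap.ext fun v => (Matrix.mulVec_mulVec v A B).symm
  map_zero' := LinearMap.ext fun v => Matrix.zero_mulVec v
  map_add' A B := LinearMap.ext fun v => Matrix.add_mulVec A B v

lemma matOp_apply (A : Matrix (Idx D) (Idx D) R) (v : Idx D → R) : matOp A v = A.mulVec v := rfl

lemma matOp_smul (c : ℝ) (A : Matrix (Idx D) (Idx D) R) : matOp (c • A) = c • matOp A :=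
  LinearMap.ext fun v => Matrix.smul_mulVec c A v

variable (d)

/-- The operator `ξ^P ∂_P` on vectors. -/
def alongOp (ξ : Idx D → R) : Module.End ℝ (Idx D → R) where
  toFun v M := dAlong d ξ (v M)
  map_add' v w := by ext M; simp
  map_smul' c v := by ext M; simp

lemma alongOp_apply (ξ v : Idx D → R) (M : Idx D) : alongOp d ξ v M = dAlong d ξ (v M) := rfl

lemma alongOp_mul_matOp (ξ : Idx D → R) (A : Matrix (Idx D) (Idx D) R) :
    alongOp d ξ * matOp A = matOp A * alongOp d ξ + matOp (A.map (dAlong d ξ)) := by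
  refine LinearMap.ext fun v => ?_
  ext M
  simp only [Module.End.mul_apply, LinearMap.add_apply, Pi.add_apply, alongOp_apply, matOp_apply,
    Matrix.mulVec, dotProduct, map_sum, Derivation.leibniz, Matrix.map_apply, smul_eq_mul,
    sum_add_distrib]
  congr 1
  exact sum_congr rfl fun K _ => mul_comm _ _

/-- The generalized Lie derivative on vectors. -/
def lieOp (ξ : Idx D → R) : Module.End ℝ (Idx D → R) := alongOp d ξ + matOp (dSkew d ξ)

variable {d}

lemma alongOp_eq_zero (hs : ∀ f g, ∑ P, d (bar P) f * d P g = 0) {χ : Idx D → R}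
    (hχ : χ ∈ quasi d) : alongOp d χ = 0 := by
  refine LinearMap.ext fun v => ?_
  ext M
  exact dAlong_eq_zero hs hχ _

lemma lieOp_of_mem_quasi (hs : ∀ f g, ∑ P, d (bar P) f * d P g = 0) {χ : Idx D → R}
    (hχ : χ ∈ quasi d) : lieOp d χ = matOp (dSkew d χ) := by
  rw [lieOp, alongOp_eq_zero hs hχ, zero_add]

lemma alongOp_mem_annih (hc : ∀ M N f, d M (d N f) = d N (d M f)) (ξ : Idx D → R)
    {v : Idx D → R} (hv : v ∈ annih d) : alongOp d ξ v ∈ annih d := by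
  intro f
  have h1 : ∑ M, d (bar M) f * (alongOp d ξ v M)
      = dAlong d ξ (∑ M, d (bar M) f * v M) - ∑ P, ξ P * ∑ M, d (bar M) (d P f) * v M := by
    simp only [alongOp_apply, map_sum, Derivation.leibniz, smul_eq_mul, sum_add_distrib]
    have : ∑ M, v M * dAlong d ξ (d (bar M) f) = ∑ P, ξ P * ∑ M, d (bar M) (d P f) * v M := by
      simp only [dAlong_apply, mul_sum]
      rw [sum_comm]
      refine sum_congr rfl fun P _ => sum_congr rfl fun M _ => ?_
      rw [hc P]; ring
    rw [this, add_sub_cancel_right]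
  have h2 : ∀ P, ∑ M, d (bar M) (d P f) * v M = 0 := fun P => hv (d P f)
  simp only [h1, h2, mul_zero, sum_const_zero, sub_zero, mem_annih.1 hv f, map_zero]

lemma lieOp_apply_of_mem_annih (ξ : Idx D → R) {v : Idx D → R} (hv : v ∈ annih d) :
    lieOp d ξ v = alongOp d ξ v + matOp (dGrad d ξ) v := by
  rw [lieOp, LinearMap.add_apply, dSkew, map_sub, LinearMap.sub_apply,
    matOp_apply (etaTr _), etaTr_dGrad_mulVec ξ hv, sub_zero]

lemma lieOp_mem_annih (hc : ∀ M N f, d M (d N f) = d N (d M f))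
    (hs : ∀ f g, ∑ P, d (bar P) f * d P g = 0) (ξ : Idx D → R)
    {v : Idx D → R} (hv : v ∈ annih d) : lieOp d ξ v ∈ annih d := by
  rw [lieOp_apply_of_mem_annih ξ hv]
  exact add_mem (alongOp_mem_annih hc ξ hv) (dGrad_mulVec_mem_annih hs ξ v)

/-- The range of the right factor lies in `annih`, which the left factor kills. All exponential
expansions in quasi-trivial directions stop at first order because of this. -/
lemma lieOp_mul_lieOp_eq_zero (hc : ∀ M N f, d M (d N f) = d N (d M f))
    (hs : ∀ f g, ∑ P, d (bar P) f * d P g = 0) {χ ψ : Idx D → R} (hχ : χ ∈ quasi d)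
    (hψ : ψ ∈ quasi d) : lieOp d χ * lieOp d ψ = 0 := by
  rw [lieOp_of_mem_quasi hs hχ, lieOp_of_mem_quasi hs hψ]
  exact LinearMap.ext fun v =>
    dSkew_mulVec_eq_zero hc hχ (dSkew_mulVec_mem_annih hc hs hψ v)

lemma etaTr_dGrad_mul_eq_zero (ξ : Idx D → R) {A : Matrix (Idx D) (Idx D) R}
    (hA : ∀ v, A.mulVec v ∈ annih d) : etaTr (dGrad d ξ) * A = 0 := by
  ext M N
  have := congrFun (etaTr_dGrad_mulVec ξ (hA (Pi.single N 1))) M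
  rwa [Matrix.mulVec_mulVec, Matrix.mulVec_single_one] at this

lemma dSkew_mul_dGrad (hc : ∀ M N f, d M (d N f) = d N (d M f))
    (hs : ∀ f g, ∑ P, d (bar P) f * d P g = 0) {χ : Idx D → R} (hχ : χ ∈ quasi d)
    (ξ : Idx D → R) : dSkew d χ * dGrad d ξ = 0 := by
  ext M N
  exact congrFun (dSkew_mulVec_eq_zero hc hχ (grad_mem_annih hs (ξ N))) M

/-- On quasi-trivial parameters, the commutator of generalized Lie derivatives is given by the Lie
derivative of one-forms. -/
lemma lieOp_commutator (hc : ∀ M N f, d M (d N f) = d N (d M f))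
    (hs : ∀ f g, ∑ P, d (bar P) f * d P g = 0) {χ : Idx D → R} (hχ : χ ∈ quasi d)
    (ξ : Idx D → R) :
    lieOp d ξ * lieOp d χ - lieOp d χ * lieOp d ξ = lieOp d (dLie d ξ χ) := by
  -- With `aᵗ dχ = 0` and `dχ a = 0`, the matrix commutator of `a - aᵗ` with `dχ` is `a dχ + dχ aᵗ`,
  -- exactly the matrix terms of `d(𝓛_ξ χ)`.
  have h1 := etaTr_dGrad_mul_eq_zero ξ (dSkew_mulVec_mem_annih hc hs hχ)
  have h2 := dSkew_mul_dGrad hc hs hχ ξ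
  rw [lieOp_of_mem_quasi hs hχ, lieOp_of_mem_quasi hs (dLie_mem_quasi hc ξ hχ), dSkew_dLie hc,
    lieOp, add_mul, mul_add, alongOp_mul_matOp, ← map_mul, ← map_mul, dSkew.eq_1 d ξ, sub_mul,
    mul_sub, h1, h2, sub_zero, zero_sub, map_neg, map_add, map_add]
  abel

end Differential

lemma matrix_map_mul_derivation {ι S : Type*} [Fintype ι] [CommRing S] [Algebra ℝ S]
    (f : Derivation ℝ S S) (A B : Matrix ι ι S) :
    (A * B).map f = A.map f * B + A * B.map f := by
  ext i j
  simp only [Matrix.map_apply, Matrix.mul_apply, map_sum, Derivation.leibniz, smul_eq_mul,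
    sum_add_distrib, Matrix.add_apply]
  rw [add_comm]
  congr 1
  exact sum_congr rfl fun K _ => mul_comm _ _

/-! ### The Jacobian of the coordinate change and the differential equation of `ℱ` -/

section Series

variable {D : ℕ} {R : Type*} [CommRing R] [Algebra ℝ R] (d : Idx D → Derivation ℝ R R)

/-- The operator `ξ^P ∂_P` on formal power series, coefficient by coefficient. -/
def fAlong (ξ : Idx D → R) : Derivation ℝ R⟦X⟧ R⟦X⟧ :=
  Derivation.mk'
    { toFun := fun φ => PowerSeries.mk fun n => dAlong d ξ (coeff n φ)
      map_add' := fun φ ψ => by ext n; simp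
      map_smul' := fun c φ => by ext n; simp }
    (fun φ ψ => by
      ext n
      simp only [LinearMap.coe_mk, AddHom.coe_mk, coeff_mk, coeff_mul, map_sum, Derivation.leibniz,
        smul_eq_mul, map_add, sum_add_distrib]
      congr 1
      rw [← Nat.sum_antidiagonal_swap]
      rfl)

lemma coeff_fAlong (ξ : Idx D → R) (φ : R⟦X⟧) (n : ℕ) :
    coeff n (fAlong d ξ φ) = dAlong d ξ (coeff n φ) := by
  simp [fAlong]

/-- The derivation `d/dλ + ξ^P ∂_P` of formal power series. -/
def flow (ξ : Idx D → R) : Derivation ℝ R⟦X⟧ R⟦X⟧ :=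
  (PowerSeries.derivative R).restrictScalars ℝ + fAlong d ξ

lemma flow_apply (ξ : Idx D → R) (φ : R⟦X⟧) :
    flow d ξ φ = PowerSeries.derivative R φ + fAlong d ξ φ := rfl

/-- The matrix `∂_M u^N` for a vector of formal power series. -/
def fGrad (u : Idx D → R⟦X⟧) : Matrix (Idx D) (Idx D) R⟦X⟧ :=
  Matrix.of fun M N => PowerSeries.mk fun n => d M (coeff n (u N))

lemma fGrad_C (ξ : Idx D → R) : fGrad d (fun M => C (ξ M)) = (dGrad d ξ).map C := by
  ext M N n
  simp only [fGrad, Matrix.of_apply, coeff_mk, Matrix.map_apply, coeff_C, dGrad_apply]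
  split_ifs <;> simp

/-- The coefficients of `ζ = X - X' = (1 - e^{-λ ξ^P ∂_P}) X`. -/
def zeta (ξ : Idx D → R) : ℕ → Idx D → R
  | 0 => 0
  | n + 1 => fun M => adCoeff n • (dAlong d ξ)^[n] (ξ M)

/-- Coefficient form of `dζ/dλ = ξ - ξ^P ∂_P ζ`, which says that `X' = X - ζ` is constant along the
flow `d/dλ + ξ^P ∂_P`. -/
lemma zeta_succ (ξ : Idx D → R) (n : ℕ) (M : Idx D) :
    ((n : ℝ) + 1) • zeta d ξ (n + 1) M
      = (if n = 0 then ξ M else 0) - dAlong d ξ (zeta d ξ n M) := by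
  rcases n with _ | n
  · simp [zeta, adCoeff_zero]
  · simp only [zeta, Derivation.map_smul, smul_smul, ← Function.iterate_succ_apply']
    push_cast
    rw [add_assoc, one_add_one_eq_two, adCoeff_succ, neg_smul, zero_sub]

/-- The matrix `A = ∂_M ζ^N`. -/
def serA (ξ : Idx D → R) : Matrix (Idx D) (Idx D) R⟦X⟧ :=
  fGrad d fun M => PowerSeries.mk fun n => zeta d ξ n M

lemma coeff_serA (ξ : Idx D → R) (n : ℕ) : (serA d ξ).map (coeff n) = dGrad d (zeta d ξ n) := by
  ext M N
  simp [serA, fGrad, dGrad_apply]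

/-- The Jacobian matrix `∂_M X'^N`. -/
def serJ (ξ : Idx D → R) : Matrix (Idx D) (Idx D) R⟦X⟧ := 1 - serA d ξ

/-- `ℱ(λ ξ) = ½ (B (Bᵗ)⁻¹ + (Bᵗ)⁻¹ B)`, where `B` is the inverse of the Jacobian matrix. -/
def serF (ξ : Idx D → R) : Matrix (Idx D) (Idx D) R⟦X⟧ :=
  (1 / 2 : ℝ) • ((serJ d ξ)⁻¹ * etaTr (serJ d ξ) + etaTr (serJ d ξ) * (serJ d ξ)⁻¹)

lemma serJ_map_constantCoeff (ξ : Idx D → R) :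
    (constantCoeff (R := R)).mapMatrix (serJ d ξ) = 1 := by
  have h : (constantCoeff (R := R)).mapMatrix (serA d ξ) = 0 := by
    ext M N
    have := congrFun (congrFun (coeff_serA d ξ 0) M) N
    simpa [dGrad_apply, zeta] using this
  rw [serJ, map_sub, map_one, h, sub_zero]

lemma isUnit_det_serJ (ξ : Idx D → R) : IsUnit (serJ d ξ).det := by
  rw [isUnit_iff_constantCoeff, RingHom.map_det, serJ_map_constantCoeff, Matrix.det_one]
  exact isUnit_one

variable {d}

lemma etaTr_fGrad_mul_fGrad (hs : ∀ f g, ∑ P, d (bar P) f * d P g = 0) (u v : Idx D → R⟦X⟧) :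
    etaTr (fGrad d u) * fGrad d v = 0 := by
  ext M N n
  simp only [Matrix.mul_apply, etaTr_apply, fGrad, Matrix.of_apply, map_sum, coeff_mul, coeff_mk,
    Matrix.zero_apply, map_zero]
  rw [sum_comm]
  exact sum_eq_zero fun p _ => hs _ _

/-- The gradient of the equation for `ζ`; the term `a * serJ` collects `∂_M ξ^N` and the commutator
of `∂_M` with `ξ^P ∂_P`. -/
lemma serA_flow (hc : ∀ M N f, d M (d N f) = d N (d M f)) (ξ : Idx D → R) :
    (serA d ξ).map (flow d ξ) = (dGrad d ξ).map C * serJ d ξ := by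
  ext M N n
  have h : coeff n (((dGrad d ξ).map C * serA d ξ) M N)
      = ∑ P, d M (ξ P) * d P (zeta d ξ n N) := by
    simp [Matrix.mul_apply, map_sum, serA, fGrad, dGrad_apply]
  have h2 : coeff n (flow d ξ (serA d ξ M N))
      = d M (((n : ℝ) + 1) • zeta d ξ (n + 1) N) + dAlong d ξ (d M (zeta d ξ n N)) := by
    rw [flow_apply, map_add, coeff_derivative, coeff_fAlong, Derivation.map_smul, Algebra.smul_def,
      mul_comm]
    simp [serA, fGrad]
  rw [Matrix.map_apply, h2, serJ, mul_sub, mul_one, Matrix.sub_apply, map_sub, h, zeta_succ,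
    map_sub, dAlong_apply, dAlong_apply, map_sum]
  have h3 : coeff n ((dGrad d ξ).map C M N) = d M (if n = 0 then ξ N else 0) := by
    rw [Matrix.map_apply, coeff_C, dGrad_apply]
    split_ifs <;> simp
  rw [h3, sub_add]
  congr 1
  rw [← sum_sub_distrib]
  refine sum_congr rfl fun P _ => ?_
  rw [Derivation.leibniz, hc P M, smul_eq_mul, smul_eq_mul]
  ring

lemma serJ_flow (hc : ∀ M N f, d M (d N f) = d N (d M f)) (ξ : Idx D → R) :
    (serJ d ξ).map (flow d ξ) = -((dGrad d ξ).map C * serJ d ξ) := by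
  rw [← serA_flow hc]
  refine Matrix.ext fun M N => ?_
  simp only [serJ, Matrix.map_apply, Matrix.sub_apply, map_sub, Matrix.neg_apply]
  rw [Matrix.one_apply]
  split_ifs <;> simp

lemma serB_flow (hc : ∀ M N f, d M (d N f) = d N (d M f)) (ξ : Idx D → R) :
    (serJ d ξ)⁻¹.map (flow d ξ) = (serJ d ξ)⁻¹ * (dGrad d ξ).map C := by
  have hJB := Matrix.mul_nonsing_inv _ (isUnit_det_serJ d ξ)
  have hBJ := Matrix.nonsing_inv_mul _ (isUnit_det_serJ d ξ)
  have h1 : (1 : Matrix (Idx D) (Idx D) R⟦X⟧).map (flow d ξ) = 0 := by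
    refine Matrix.ext fun M N => ?_
    rw [Matrix.map_apply, Matrix.one_apply]
    split_ifs <;> simp
  -- The derivative of an inverse matrix, from differentiating `B J = 1`.
  have h := matrix_map_mul_derivation (flow d ξ) (serJ d ξ)⁻¹ (serJ d ξ)
  rw [hBJ, h1, serJ_flow hc] at h
  have h2 := congrArg (· * (serJ d ξ)⁻¹) h
  simp only [zero_mul, add_mul, mul_neg, neg_mul, mul_assoc, hJB, mul_one] at h2
  exact (sub_eq_zero.1 ((sub_eq_add_neg _ _).trans h2.symm))

/-- The differential equation for `ℱ(λ ξ)`. -/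
lemma serF_flow (hc : ∀ M N f, d M (d N f) = d N (d M f))
    (hs : ∀ f g, ∑ P, d (bar P) f * d P g = 0) (ξ : Idx D → R) :
    (serF d ξ).map (flow d ξ)
      = serF d ξ * ((dGrad d ξ).map C - etaTr ((dGrad d ξ).map C))
        + (1 / 2 : ℝ) • ((serJ d ξ)⁻¹ * (serA d ξ * etaTr ((dGrad d ξ).map C)
            - (dGrad d ξ).map C * etaTr (serA d ξ))) := by
  have hJB := Matrix.mul_nonsing_inv _ (isUnit_det_serJ d ξ)
  have hBJ := Matrix.nonsing_inv_mul _ (isUnit_det_serJ d ξ)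
  have hB := serB_flow hc ξ
  have hC : (etaTr (serJ d ξ)).map (flow d ξ)
      = -(etaTr (serJ d ξ) * etaTr ((dGrad d ξ).map C)) := by
    rw [← etaTr_mul, ← etaTr_map, serJ_flow hc]; rfl
  -- The strong constraint enters here: a transposed gradient matrix times a gradient matrix
  -- contracts gradients with `η`.
  have haA : etaTr ((dGrad d ξ).map C) * serA d ξ = 0 := by
    rw [← fGrad_C]; exact etaTr_fGrad_mul_fGrad hs _ _
  have hAa : etaTr (serA d ξ) * (dGrad d ξ).map C = 0 := by
    rw [← fGrad_C]; exact etaTr_fGrad_mul_fGrad hs _ _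
  have hAA : etaTr (serA d ξ) * serA d ξ = 0 := etaTr_fGrad_mul_fGrad hs _ _
  have hJ : serJ d ξ = 1 - serA d ξ := rfl
  have hJt : etaTr (serJ d ξ) = 1 - etaTr (serA d ξ) := by rw [hJ, etaTr_sub, etaTr_one]
  have hsm : ∀ M : Matrix (Idx D) (Idx D) R⟦X⟧,
      ((1 / 2 : ℝ) • M).map (flow d ξ) = (1 / 2 : ℝ) • M.map (flow d ξ) := fun M => by
    refine Matrix.ext fun i j => ?_
    exact (flow d ξ).map_smul (1 / 2 : ℝ) (M i j)
  have hadd : ∀ M N : Matrix (Idx D) (Idx D) R⟦X⟧,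
      (M + N).map (flow d ξ) = M.map (flow d ξ) + N.map (flow d ξ) := fun M N => by
    refine Matrix.ext fun i j => ?_
    exact map_add (flow d ξ) (M i j) (N i j)
  rw [serF, hsm, hadd, matrix_map_mul_derivation, matrix_map_mul_derivation, hB, hC,
    smul_mul_assoc, ← smul_add]
  congr 1
  rw [hJt]
  generalize (serJ d ξ)⁻¹ = B at *
  generalize etaTr (serA d ξ) = At at *
  generalize etaTr ((dGrad d ξ).map C) = at' at *
  generalize (dGrad d ξ).map C = a at *
  rw [hJ] at hJB hBJ
  generalize serA d ξ = A at *
  -- Since `aᵗ A = 0`, inserting `(1 - A) B = 1` lets `aᵗ` absorb `B`; the same holds for `Aᵗ`.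
  have haB : at' * B = at' := by
    have : at' * ((1 - A) * B) = at' * B := by
      rw [← mul_assoc, mul_sub, haA, mul_one, sub_zero]
    rw [← this, hJB, mul_one]
  have hAB : At * B = At := by
    have : At * ((1 - A) * B) = At * B := by
      rw [← mul_assoc, mul_sub, hAA, mul_one, sub_zero]
    rw [← this, hJB, mul_one]
  have hBA : B * A = B - 1 := by
    rw [mul_sub, mul_one] at hBJ
    rw [← hBJ, sub_sub_cancel]
  simp only [sub_mul, mul_sub, add_mul, one_mul, mul_one, mul_neg, neg_mul, mul_assoc,
    hAa, haB, mul_zero]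
  simp only [← mul_assoc, hAB, hBA, sub_mul, one_mul, hAa]
  abel

end Series

/-! ### Operator series: the identities between `𝒢` and `ℱ` -/

section Operators

variable {D : ℕ} {R : Type*} [CommRing R] [Algebra ℝ R] {d : Idx D → Derivation ℝ R R}

/-- The operator series of multiplication by a matrix of formal power series. -/
def serOp : Matrix (Idx D) (Idx D) R⟦X⟧ →+* (Module.End ℝ (Idx D → R))⟦X⟧ where
  toFun A := PowerSeries.mk fun n => matOp (A.map (coeff n))
  map_zero' := by
    ext1 n
    rw [coeff_mk, Matrix.map_zero _ (map_zero _), map_zero, map_zero]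
  map_add' A B := by
    ext1 n
    rw [map_add, coeff_mk, coeff_mk, coeff_mk, Matrix.map_add _ (map_add _), map_add]
  map_one' := by
    ext1 n
    rw [coeff_mk, coeff_one]
    have h : (1 : Matrix (Idx D) (Idx D) R⟦X⟧).map (coeff n) = if n = 0 then 1 else 0 := by
      refine Matrix.ext fun i j => ?_
      rw [Matrix.map_apply, Matrix.one_apply]
      split_ifs with h1 h2 h2 <;> simp [coeff_one, h1, h2, Matrix.one_apply]
    rw [h]
    split_ifs <;> simp
  map_mul' A B := by
    ext1 n
    rw [coeff_mul, coeff_mk]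
    simp only [coeff_mk, ← map_mul, ← map_sum]
    congr 1
    refine Matrix.ext fun i j => ?_
    simp only [Matrix.map_apply, Matrix.mul_apply, map_sum, coeff_mul, Matrix.sum_apply]
    rw [sum_comm]

lemma coeff_serOp (A : Matrix (Idx D) (Idx D) R⟦X⟧) (n : ℕ) :
    coeff n (serOp A) = matOp (A.map (coeff n)) := by
  simp [serOp]

lemma serOp_map_C (A : Matrix (Idx D) (Idx D) R) : serOp (A.map C) = C (matOp A) := by
  ext1 n
  rw [coeff_serOp, coeff_C]
  have h : (A.map C).map (coeff n) = if n = 0 then A else 0 := by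
    refine Matrix.ext fun i j => ?_
    rw [Matrix.map_apply, Matrix.map_apply, coeff_C]
    split_ifs <;> rfl
  rw [h]
  split_ifs <;> simp

lemma serOp_smul (c : ℝ) (A : Matrix (Idx D) (Idx D) R⟦X⟧) : serOp (c • A) = c • serOp A := by
  ext1 n
  rw [coeff_smul, coeff_serOp, coeff_serOp, ← matOp_smul]
  rfl

/-- The part `ξ^P ∂_P A` of the flow is the commutator of `ξ^P ∂_P` with multiplication by `A`;
subtracting it leaves `dA/dλ`. -/
lemma dser_serOp (ξ : Idx D → R) (A : Matrix (Idx D) (Idx D) R⟦X⟧) :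
    dser (serOp A) = serOp (A.map (flow d ξ))
      + serOp A * C (alongOp d ξ) - C (alongOp d ξ) * serOp A := by
  ext1 n
  rw [coeff_dser, map_sub, map_add, coeff_mul_C, coeff_C_mul, coeff_serOp, coeff_serOp, coeff_serOp,
    alongOp_mul_matOp, ← matOp_smul]
  have h : (A.map (flow d ξ)).map (coeff n)
      = ((n : ℝ) + 1) • A.map (coeff (n + 1)) + (A.map (coeff n)).map (dAlong d ξ) := by
    refine Matrix.ext fun i j => ?_
    simp only [Matrix.map_apply, flow_apply, map_add, coeff_derivative, coeff_fAlong,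
      Matrix.add_apply, Matrix.smul_apply]
    rw [Algebra.smul_def, mul_comm]
    simp
  rw [h, map_add]
  abel

/-- The operator series of the generalized Lie derivative along a formal parameter. -/
def lieSer (d : Idx D → Derivation ℝ R R) (χ : ℕ → Idx D → R) :
    (Module.End ℝ (Idx D → R))⟦X⟧ := PowerSeries.mk fun n => lieOp d (χ n)

lemma coeff_lieSer (χ : ℕ → Idx D → R) (n : ℕ) : coeff n (lieSer d χ) = lieOp d (χ n) :=
  coeff_mk _ _

/-- The operator series of `𝒢(λ ξ)`. -/
def serG (d : Idx D → Derivation ℝ R R) (ξ : Idx D → R) : (Module.End ℝ (Idx D → R))⟦X⟧ :=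
  pexp (X * C (-alongOp d ξ)) * pexp (X * C (lieOp d ξ))

lemma dser_serG (ξ : Idx D → R) :
    dser (serG d ξ) = serG d ξ * C (lieOp d ξ) - C (alongOp d ξ) * serG d ξ := by
  rw [serG, dser_pexp_mul_pexp]

lemma coeff_zero_serG (ξ : Idx D → R) : coeff 0 (serG d ξ) = 1 := by
  rw [serG, coeff_zero_mul, coeff_zero_pexp_X_mul_C, coeff_zero_pexp_X_mul_C, one_mul]

lemma lieSer_mul_lieSer (hc : ∀ M N f, d M (d N f) = d N (d M f))
    (hs : ∀ f g, ∑ P, d (bar P) f * d P g = 0) {χ ψ : ℕ → Idx D → R} (hχ : ∀ n, χ n ∈ quasi d)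
    (hψ : ∀ n, ψ n ∈ quasi d) : lieSer d χ * lieSer d ψ = 0 := by
  ext1 n
  rw [coeff_mul, map_zero]
  exact sum_eq_zero fun p _ => by
    rw [coeff_lieSer, coeff_lieSer, lieOp_mul_lieOp_eq_zero hc hs (hχ _) (hψ _)]

lemma dLie_iterate_mem_quasi (hc : ∀ M N f, d M (d N f) = d N (d M f)) (ξ : Idx D → R)
    {χ : Idx D → R} (hχ : χ ∈ quasi d) (j : ℕ) : (dLie d ξ)^[j] χ ∈ quasi d := by
  induction j with
  | zero => exact hχ
  | succ j ih =>
    rw [Function.iterate_succ_apply']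
    exact dLie_mem_quasi hc ξ ih

lemma adC_iterate_lieSer (hc : ∀ M N f, d M (d N f) = d N (d M f))
    (hs : ∀ f g, ∑ P, d (bar P) f * d P g = 0) {χ : ℕ → Idx D → R} (hχ : ∀ n, χ n ∈ quasi d)
    (ξ : Idx D → R) (j : ℕ) :
    (adC (lieOp d ξ))^[j] (lieSer d χ) = lieSer d fun n => (dLie d ξ)^[j] (χ n) := by
  induction j with
  | zero => rfl
  | succ j ih =>
    rw [Function.iterate_succ_apply', ih]
    ext1 n
    rw [adC, map_sub, coeff_C_mul, coeff_mul_C, coeff_lieSer, coeff_lieSer,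
      lieOp_commutator hc hs (dLie_iterate_mem_quasi hc ξ (hχ n) j), Function.iterate_succ_apply']

/-- For `u = ζ` this exhibits the source `A aᵗ - a Aᵗ` as the exterior derivative of a quasi-trivial
parameter, which is what permits a recursion for `χ` itself. -/
lemma dSkew_sum_mul_grad (hc : ∀ M N f, d M (d N f) = d N (d M f)) (u ξ : Idx D → R) :
    dSkew d (fun M => ∑ K, u K * d (bar M) (ξ (bar K)))
      = dGrad d u * etaTr (dGrad d ξ) - dGrad d ξ * etaTr (dGrad d u) := by
  ext M N
  have h : (dGrad d ξ * etaTr (dGrad d u)) M N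
      = ∑ K, d M (ξ (bar K)) * d (bar N) (u K) := by
    rw [Matrix.mul_apply, ← sum_bar]
    simp only [etaTr_apply, dGrad_apply, bar_bar]
  rw [Matrix.sub_apply, h, Matrix.mul_apply]
  simp only [dSkew_apply, etaTr_apply, dGrad_apply, map_sum, Derivation.leibniz, smul_eq_mul,
    bar_bar, ← sum_sub_distrib]
  refine sum_congr rfl fun K _ => ?_
  rw [hc M]
  ring

lemma serJ_map_coeff_zero (ξ : Idx D → R) : (serJ d ξ).map (coeff 0) = 1 := by
  rw [← serJ_map_constantCoeff d ξ]
  refine Matrix.ext fun i j => ?_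
  simp

lemma coeff_zero_serB (ξ : Idx D → R) : coeff 0 (serOp (serJ d ξ)⁻¹) = 1 := by
  have h := congrArg (fun A => serOp A) (Matrix.nonsing_inv_mul _ (isUnit_det_serJ d ξ))
  simp only [map_mul, map_one] at h
  have := congrArg (coeff 0) h
  rwa [coeff_zero_mul, coeff_serOp (serJ d ξ), serJ_map_coeff_zero, map_one, mul_one,
    coeff_zero_one] at this

lemma coeff_zero_serF (ξ : Idx D → R) : coeff 0 (serOp (serF d ξ)) = 1 := by
  have h : coeff 0 (serOp (etaTr (serJ d ξ))) = 1 := by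
    rw [coeff_serOp, ← etaTr_map, serJ_map_coeff_zero, etaTr_one, map_one]
  rw [serF, serOp_smul, map_add, map_mul, map_mul, coeff_smul, map_add, coeff_zero_mul,
    coeff_zero_mul, coeff_zero_serB, h, mul_one, smul_add, ← add_smul, add_halves, one_smul]

/-- The operators `𝒢(λ ξ)` and `B` agree on the vectors annihilated by gradients. -/
lemma serG_sub_serB_apply (hc : ∀ M N f, d M (d N f) = d N (d M f))
    (hs : ∀ f g, ∑ P, d (bar P) f * d P g = 0) (ξ : Idx D → R) (n : ℕ) {v : Idx D → R}
    (hv : v ∈ annih d) : coeff n (serG d ξ - serOp (serJ d ξ)⁻¹) v = 0 := by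
  have hB := dser_serOp (d := d) ξ (serJ d ξ)⁻¹
  rw [serB_flow hc, map_mul, serOp_map_C] at hB
  -- The vector must vary, because the equation of `𝒢` involves `L_ξ v`, which is again in `annih`.
  -- There `L_ξ` acts as `ξ^P ∂_P + a`, and the equations of `𝒢` and `B` coincide.
  induction n generalizing v with
  | zero => rw [map_sub, coeff_zero_serG, coeff_zero_serB, sub_self, LinearMap.zero_apply]
  | succ n ih =>
    have e1 := congrArg (coeff n) (dser_serG (d := d) ξ)
    have e2 := congrArg (coeff n) hB
    simp only [coeff_dser, map_sub, map_add, coeff_mul_C, coeff_C_mul] at e1 e2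
    have e3 := LinearMap.congr_fun e1 v
    have e4 := LinearMap.congr_fun e2 v
    simp only [LinearMap.smul_apply, LinearMap.sub_apply, LinearMap.add_apply,
      Module.End.mul_apply] at e3 e4
    have i1 := ih hv
    have i2 := ih (lieOp_mem_annih hc hs ξ hv)
    rw [map_sub, LinearMap.sub_apply, sub_eq_zero] at i1 i2 ⊢
    have hn : ((n : ℝ) + 1) ≠ 0 := by positivity
    refine smul_right_injective _ hn ?_
    simp only [e3, e4, i1, i2]
    rw [lieOp_apply_of_mem_annih ξ hv, map_add]
    abel

lemma serG_mul_lieSer (hc : ∀ M N f, d M (d N f) = d N (d M f))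
    (hs : ∀ f g, ∑ P, d (bar P) f * d P g = 0) (ξ : Idx D → R) {χ : ℕ → Idx D → R}
    (hχ : ∀ n, χ n ∈ quasi d) :
    serG d ξ * lieSer d χ = serOp (serJ d ξ)⁻¹ * lieSer d χ := by
  rw [← sub_eq_zero, ← sub_mul]
  ext1 n
  rw [coeff_mul, map_zero]
  refine sum_eq_zero fun p _ => LinearMap.ext fun v => ?_
  rw [Module.End.mul_apply, coeff_lieSer, lieOp_of_mem_quasi hs (hχ _)]
  exact serG_sub_serB_apply hc hs ξ _ (dSkew_mulVec_mem_annih hc hs (hχ _) v)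

/-- The recursion for the parameter `χ`. -/
def ChiRec (d : Idx D → Derivation ℝ R R) (ξ : Idx D → R) (χ : ℕ → Idx D → R) : Prop :=
  ∀ n : ℕ, ((n : ℝ) + 1) • χ (n + 1) + dLie d ξ (χ n)
    = (1 / 2 : ℝ) • fun M => ∑ K, zeta d ξ n K * d (bar M) (ξ (bar K))

lemma ChiRec.dSkew_eq (hc : ∀ M N f, d M (d N f) = d N (d M f)) {ξ : Idx D → R}
    {χ : ℕ → Idx D → R} (h : ChiRec d ξ χ) (n : ℕ) :
    ((n : ℝ) + 1) • dSkew d (χ (n + 1))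
        + ((dSkew d (χ n)).map (dAlong d ξ) + dGrad d ξ * dSkew d (χ n))
        + dSkew d (χ n) * etaTr (dGrad d ξ)
      = (1 / 2 : ℝ) • (dGrad d (zeta d ξ n) * etaTr (dGrad d ξ)
          - dGrad d ξ * etaTr (dGrad d (zeta d ξ n))) := by
  have h1 := congrArg (DFT.dSkew d) (h n)
  rw [dSkew_add, dSkew_smul, dSkew_dLie hc, dSkew_smul, dSkew_sum_mul_grad hc] at h1
  rw [← h1]
  abel

/-- `𝒢(λ ξ) (1 + Δ - Δᵗ) = ℱ(λ ξ)`. -/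
lemma ChiRec.serG_mul (hc : ∀ M N f, d M (d N f) = d N (d M f))
    (hs : ∀ f g, ∑ P, d (bar P) f * d P g = 0) {ξ : Idx D → R}
    {χ : ℕ → Idx D → R} (h : ChiRec d ξ χ) (hχ : ∀ n, χ n ∈ quasi d) (h0 : χ 0 = 0) :
    serG d ξ * (1 + lieSer d χ) = serOp (serF d ξ) := by
  -- The coefficients of `dχ/dλ + 𝓛_ξ χ`. Being quasi-trivial, they have operators with range in
  -- `annih`, where `𝒢` may be replaced by `B`.
  set q : ℕ → Idx D → R := fun n => ((n : ℝ) + 1) • χ (n + 1) + dLie d ξ (χ n) with hq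
  have hqm : ∀ n, q n ∈ quasi d := fun n =>
    add_mem (Submodule.smul_mem _ _ (hχ _)) (dLie_mem_quasi hc ξ (hχ n))
  have hqs : lieSer d q = (1 / 2 : ℝ) • serOp (serA d ξ * etaTr ((dGrad d ξ).map C)
      - (dGrad d ξ).map C * etaTr (serA d ξ)) := by
    ext1 n
    rw [coeff_lieSer, coeff_smul, coeff_serOp, lieOp_of_mem_quasi hs (hqm n), hq]
    simp only
    rw [h n, dSkew_smul, matOp_smul, dSkew_sum_mul_grad hc, ← coeff_serA]
    congr 2
    ext M N
    simp [Matrix.mul_apply, etaTr_apply]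
  have hW : dser (lieSer d χ)
      = lieSer d q - C (lieOp d ξ) * lieSer d χ + lieSer d χ * C (lieOp d ξ) := by
    ext1 n
    rw [coeff_dser, map_add, map_sub, coeff_C_mul, coeff_mul_C, coeff_lieSer, coeff_lieSer,
      coeff_lieSer, sub_add, lieOp_commutator hc hs (hχ n), lieOp_of_mem_quasi hs (hqm n),
      lieOp_of_mem_quasi hs (hχ _), lieOp_of_mem_quasi hs (dLie_mem_quasi hc ξ (hχ n)), hq,
      dSkew_add, map_add, dSkew_smul, matOp_smul, add_sub_cancel_right]
  have hF := dser_serOp (d := d) ξ (serF d ξ)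
  rw [serF_flow hc hs, map_add, map_mul, serOp_smul, map_mul, ← mul_smul_comm, ← hqs, map_sub,
    etaTr_map, serOp_map_C, serOp_map_C, ← map_sub, ← map_sub] at hF
  have hG := dser_serG (d := d) ξ
  have hGq := serG_mul_lieSer hc hs ξ hqm
  refine eq_of_dser_eq ?_ hG hW ?_ hGq
  · rw [map_sub, coeff_zero_mul, map_add, coeff_zero_serG, coeff_zero_serF, coeff_zero_one,
      coeff_lieSer, h0, lieOp_of_mem_quasi hs (zero_mem _), dSkew_zero, map_zero, add_zero, one_mul,
      sub_self]
  · rw [hF, lieOp, map_add, mul_add]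
    rw [DFT.dSkew]
    abel

/-- The recursion expressing `χ` in terms of `δ`. -/
def DeltaRec (d : Idx D → Derivation ℝ R R) (ξ : Idx D → R) (χ δ : ℕ → Idx D → R) : Prop :=
  ∀ n : ℕ, χ n = ∑ j ∈ range (n + 1), adCoeff j • (dLie d ξ)^[j] (δ (n - j))

lemma pexp_lieSer (hc : ∀ M N f, d M (d N f) = d N (d M f))
    (hs : ∀ f g, ∑ P, d (bar P) f * d P g = 0) {χ : ℕ → Idx D → R}
    (hχ : ∀ n, χ n ∈ quasi d) (h0 : χ 0 = 0) : pexp (lieSer d χ) = 1 + lieSer d χ := by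
  refine pexp_of_mul_self_eq_zero (lieSer_mul_lieSer hc hs hχ hχ) ?_
  rw [coeff_lieSer, h0, lieOp_of_mem_quasi hs (zero_mem _), dSkew_zero, map_zero]

lemma DeltaRec.pexp_add (hc : ∀ M N f, d M (d N f) = d N (d M f))
    (hs : ∀ f g, ∑ P, d (bar P) f * d P g = 0) {ξ : Idx D → R} {χ δ : ℕ → Idx D → R}
    (h : DeltaRec d ξ χ δ) (hχ : ∀ n, χ n ∈ quasi d) (hδ : ∀ n, δ n ∈ quasi d) (h0 : δ 0 = 0) :
    pexp (X * C (lieOp d ξ) + lieSer d δ) = pexp (X * C (lieOp d ξ)) * (1 + lieSer d χ) := by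
  refine DFT.pexp_add _ _ _ (fun j => ?_) ?_ fun n => ?_
  · rw [adC_iterate_lieSer hc hs hδ]
    exact lieSer_mul_lieSer hc hs (fun n => dLie_iterate_mem_quasi hc ξ (hδ n) j) hδ
  · rw [coeff_lieSer, h0, lieOp_of_mem_quasi hs (zero_mem _), dSkew_zero, map_zero]
  · have hlin : ∀ (s : Finset ℕ) (c : ℕ → ℝ) (u : ℕ → Idx D → R),
        matOp (dSkew d (∑ j ∈ s, c j • u j)) = ∑ j ∈ s, c j • matOp (dSkew d (u j)) := by
      intro s c u
      induction s using Finset.induction_on with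
      | empty => simp [dSkew_zero]
      | insert a s ha ih => rw [sum_insert ha, sum_insert ha, dSkew_add, dSkew_smul, map_add,
          matOp_smul, ih]
    rw [coeff_lieSer, lieOp_of_mem_quasi hs (hχ n), h n, hlin]
    refine sum_congr rfl fun j _ => ?_
    rw [adC_iterate_lieSer hc hs hδ, coeff_lieSer,
      lieOp_of_mem_quasi hs (dLie_iterate_mem_quasi hc ξ (hδ _) j)]

end Operators

/-! ## Algebras of smooth functions -/

section Smooth

variable {D : ℕ}

/-- A subalgebra of smooth functions, stable under partial derivatives. -/
structure IsDiffAlgebra (𝒜 : Subalgebra ℝ (Fn D)) : Prop where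
  smooth : ∀ A ∈ 𝒜, ContDiff ℝ ∞ A
  pd_mem : ∀ A ∈ 𝒜, ∀ M, pd M A ∈ 𝒜

lemma IsFieldAlgebra.isDiffAlgebra {𝒜 : Subalgebra ℝ (Fn D)} (h : IsFieldAlgebra 𝒜) :
    IsDiffAlgebra 𝒜 := ⟨h.smooth, h.pd_mem⟩

lemma pd_zero (M : Idx D) : pd M (0 : Fn D) = 0 := by
  ext x
  simp only [pd, Pi.zero_apply]
  rw [show (0 : Fn D) = fun _ => (0 : ℝ) from rfl, fderiv_fun_const]
  simp

lemma pd_add (M : Idx D) {f g : Fn D} (hf : ContDiff ℝ ∞ f) (hg : ContDiff ℝ ∞ g) :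
    pd M (f + g) = pd M f + pd M g := by
  ext x
  simp only [pd, Pi.add_apply]
  rw [fderiv_add (hf.differentiable (by simp) x) (hg.differentiable (by simp) x)]
  rfl

lemma pd_smul (M : Idx D) (c : ℝ) {f : Fn D} (hf : ContDiff ℝ ∞ f) :
    pd M (c • f) = c • pd M f := by
  ext x
  simp only [pd, Pi.smul_apply]
  rw [fderiv_const_smul (hf.differentiable (by simp) x)]
  rfl

lemma pd_mul (M : Idx D) {f g : Fn D} (hf : ContDiff ℝ ∞ f) (hg : ContDiff ℝ ∞ g) :
    pd M (f * g) = f * pd M g + g * pd M f := by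
  ext x
  simp only [pd, Pi.add_apply, Pi.mul_apply]
  rw [fderiv_mul (hf.differentiable (by simp) x) (hg.differentiable (by simp) x)]
  simp

lemma pd_neg (M : Idx D) (f : Fn D) : pd M (-f) = -pd M f := by
  ext x
  simp only [pd, Pi.neg_apply]
  rw [fderiv_neg]
  rfl

lemma contDiff_pd (M : Idx D) {f : Fn D} (hf : ContDiff ℝ ∞ f) : ContDiff ℝ ∞ (pd M f) :=
  (hf.fderiv_right (m := ∞) (by simp)).clm_apply contDiff_const

lemma pd_comm (M N : Idx D) {f : Fn D} (hf : ContDiff ℝ ∞ f) :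
    pd M (pd N f) = pd N (pd M f) := by
  have key : ∀ M N : Idx D, ∀ x, pd M (pd N f) x
      = fderiv ℝ (fderiv ℝ f) x (Pi.single M 1) (Pi.single N 1) := by
    intro M N x
    have hd : DifferentiableAt ℝ (fderiv ℝ f) x :=
      (hf.fderiv_right (m := ∞) (by simp)).differentiable (by simp) x
    have : pd N f = fun y => fderiv ℝ f y (Pi.single N 1) := rfl
    rw [this, pd, fderiv_clm_apply hd (differentiableAt_const _)]
    simp
  ext x
  rw [key, key]
  exact (hf.contDiffAt.isSymmSndFDerivAt (by
    rw [minSmoothness_of_isRCLikeNormedField]; exact WithTop.coe_le_coe.2 le_top)).eq _ _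

/-- The algebra of all smooth functions. -/
def smoothAlg (D : ℕ) : Subalgebra ℝ (Fn D) where
  carrier := {f | ContDiff ℝ ∞ f}
  mul_mem' {f g} (hf : ContDiff ℝ ∞ f) (hg : ContDiff ℝ ∞ g) := hf.mul hg
  add_mem' {f g} (hf : ContDiff ℝ ∞ f) (hg : ContDiff ℝ ∞ g) := hf.add hg
  algebraMap_mem' c := (contDiff_const : ContDiff ℝ ∞ fun _ : Space D => c)

lemma isDiffAlgebra_smoothAlg : IsDiffAlgebra (smoothAlg D) :=
  ⟨fun _ h => h, fun _ h M => contDiff_pd M h⟩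

variable {𝒜 : Subalgebra ℝ (Fn D)}

/-- The partial derivative as a derivation of an algebra of smooth functions. -/
def pdDer (h : IsDiffAlgebra 𝒜) (M : Idx D) : Derivation ℝ 𝒜 𝒜 :=
  Derivation.mk'
    { toFun := fun f => ⟨pd M f, h.pd_mem f f.2 M⟩
      map_add' := fun f g => Subtype.ext (pd_add M (h.smooth f f.2) (h.smooth g g.2))
      map_smul' := fun c f => Subtype.ext (pd_smul M c (h.smooth f f.2)) }
    fun f g => Subtype.ext (pd_mul M (h.smooth f f.2) (h.smooth g g.2))

lemma coe_pdDer (h : IsDiffAlgebra 𝒜) (M : Idx D) (f : 𝒜) : (pdDer h M f : Fn D) = pd M f := rfl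

lemma pdDer_comm (h : IsDiffAlgebra 𝒜) (M N : Idx D) (f : 𝒜) :
    pdDer h M (pdDer h N f) = pdDer h N (pdDer h M f) :=
  Subtype.ext (pd_comm M N (h.smooth f f.2))

/-- Polarization: `∂^P ∂_P` applied to the product `f g` leaves twice the mixed term. -/
lemma pdDer_strong (h : IsFieldAlgebra 𝒜) (f g : 𝒜) :
    ∑ P, pdDer h.isDiffAlgebra (bar P) f * pdDer h.isDiffAlgebra P g = 0 := by
  set d := pdDer h.isDiffAlgebra with hd
  have h2 : ∀ f : 𝒜, ∑ P, d (bar P) (d P f) = 0 := fun f => Subtype.ext <| by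
    rw [AddSubmonoidClass.coe_finsetSum]
    exact h.strong_constraint f f.2
  have h3 := h2 (f * g)
  simp only [Derivation.leibniz, smul_eq_mul, map_add, sum_add_distrib, ← mul_sum, h2, mul_zero,
    zero_add] at h3
  have h4 : ∑ P, d P f * d (bar P) g = ∑ P, d (bar P) f * d P g := by
    rw [← sum_bar]; simp only [bar_bar]
  have h5 : ∑ P, d P g * d (bar P) f = ∑ P, d (bar P) f * d P g :=
    sum_congr rfl fun P _ => mul_comm _ _
  rw [h5, h4] at h3
  have h6 : ∀ x : 𝒜, x + x = 0 → x = 0 := fun x hx => by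
    rw [← one_smul ℝ x, ← add_halves (1 : ℝ), add_smul, ← smul_add, hx, smul_zero]
  exact h6 _ h3

end Smooth

/-! ## Quasi-trivial parameters -/

section QuasiTrivial

variable {D : ℕ}

/-- A parameter with smooth components. -/
def IsSmooth (ξ : Param D) : Prop := ∀ M, ContDiff ℝ ∞ (ξ M)

lemma IsDiffPoly.mem {𝒜 : Subalgebra ℝ (Fn D)} (h : IsDiffAlgebra 𝒜) {n : ℕ}
    {T : Param D → Fn D} (hT : IsDiffPoly n T) {ξ : Param D} (hξ : ∀ M, ξ M ∈ 𝒜) : T ξ ∈ 𝒜 := by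
  induction hT with
  | comp M => exact hξ M
  | const c => exact 𝒜.algebraMap_mem c
  | zero n => exact zero_mem _
  | add _ _ h1 h2 => exact add_mem h1 h2
  | mul _ _ h1 h2 => exact mul_mem h1 h2
  | pd M _ h1 => exact h.pd_mem _ h1 M

lemma IsDiffPoly.sum {ι : Type*} (s : Finset ι) {n : ℕ} {T : ι → Param D → Fn D}
    (hT : ∀ i ∈ s, IsDiffPoly n (T i)) : IsDiffPoly n fun ξ => ∑ i ∈ s, T i ξ := by
  classical
  induction s using Finset.induction_on with
  | empty => exact .zero n
  | insert a s ha ih =>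
    simp only [sum_insert ha]
    exact (hT a (mem_insert_self _ _)).add (ih fun i hi => hT i (mem_insert_of_mem hi))

lemma IsDiffPoly.along {n : ℕ} {T : Param D → Fn D} (hT : IsDiffPoly n T) :
    IsDiffPoly (n + 1) fun ξ => DFT.along ξ (T ξ) := by
  rw [add_comm]
  exact .sum _ fun P _ => .mul (.comp P) (.pd P hT)

lemma IsDiffPoly.smul {n : ℕ} {T : Param D → Fn D} (hT : IsDiffPoly n T) (c : ℝ) :
    IsDiffPoly n fun ξ => c • T ξ := by
  have := IsDiffPoly.mul (.const c) hT
  rw [zero_add] at this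
  exact this

lemma IsQuasiTrivialOfOrder.of_fintype {ι : Type} [Fintype ι] {n : ℕ} {δ : Param D → Param D}
    (p q : ι → ℕ) (ρ η : ι → Param D → Fn D)
    (h : ∀ i, p i + q i = n ∧ IsDiffPoly (p i) (ρ i) ∧ IsDiffPoly (q i) (η i))
    (hδ : ∀ ξ M, δ ξ M = ∑ i, ρ i ξ * pd (bar M) (η i ξ)) : IsQuasiTrivialOfOrder n δ := by
  let e := (Fintype.equivFin ι).symm
  refine ⟨_, p ∘ e, q ∘ e, fun i => ρ (e i), fun i => η (e i), fun i => h (e i), fun ξ M => ?_⟩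
  rw [hδ]
  exact (e.sum_comp fun i => ρ i ξ * pd (bar M) (η i ξ)).symm

lemma IsQuasiTrivialOfOrder.zero (n : ℕ) :
    IsQuasiTrivialOfOrder n (fun _ => 0 : Param D → Param D) :=
  .of_fintype (ι := Empty) nofun nofun nofun nofun nofun fun ξ M => by simp

lemma IsQuasiTrivialOfOrder.add {n : ℕ} {δ ε : Param D → Param D}
    (hδ : IsQuasiTrivialOfOrder n δ) (hε : IsQuasiTrivialOfOrder n ε) :
    IsQuasiTrivialOfOrder n fun ξ => δ ξ + ε ξ := by
  obtain ⟨m, p, q, ρ, η, h, hδ⟩ := hδ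
  obtain ⟨m', p', q', ρ', η', h', hε⟩ := hε
  refine .of_fintype (ι := Fin m ⊕ Fin m') (Sum.elim p p') (Sum.elim q q') (Sum.elim ρ ρ')
    (Sum.elim η η') ?_ fun ξ M => ?_
  · rintro (i | i)
    exacts [h i, h' i]
  · rw [Pi.add_apply, hδ, hε, Fintype.sum_sum_type]
    rfl

lemma IsQuasiTrivialOfOrder.smul {n : ℕ} {δ : Param D → Param D}
    (hδ : IsQuasiTrivialOfOrder n δ) (c : ℝ) : IsQuasiTrivialOfOrder n fun ξ => c • δ ξ := by
  obtain ⟨m, p, q, ρ, η, h, hδ⟩ := hδ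
  refine ⟨m, p, q, fun i ξ => c • ρ i ξ, η, fun i => ⟨(h i).1, (h i).2.1.smul c, (h i).2.2⟩,
    fun ξ M => ?_⟩
  change c • δ ξ M = _
  rw [hδ, smul_sum]
  exact sum_congr rfl fun i _ => (smul_mul_assoc _ _ _).symm

/-- The vector of functions underlying a vector over a subalgebra. -/
def coeV {𝒜 : Subalgebra ℝ (Fn D)} (v : Idx D → 𝒜) : Param D := fun M => (v M : Fn D)

lemma coeV_injective {𝒜 : Subalgebra ℝ (Fn D)} :
    Function.Injective (coeV : (Idx D → 𝒜) → Param D) := fun _ _ h =>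
  funext fun M => Subtype.ext (congrFun h M)

lemma IsQuasiTrivialOfOrder.exists_mem_quasi {𝒜 : Subalgebra ℝ (Fn D)} (h : IsDiffAlgebra 𝒜)
    {n : ℕ} {δ : Param D → Param D} (hδ : IsQuasiTrivialOfOrder n δ) {ξ : Param D}
    (hξ : ∀ M, ξ M ∈ 𝒜) : ∃ v ∈ quasi (pdDer h), coeV v = δ ξ := by
  obtain ⟨m, p, q, ρ, η, hp, hδ⟩ := hδ
  refine ⟨∑ i, fun M => ⟨ρ i ξ, (hp i).2.1.mem h hξ⟩
    * pdDer h (bar M) ⟨η i ξ, (hp i).2.2.mem h hξ⟩,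
    sum_mem fun i _ => Submodule.subset_span ⟨_, _, rfl⟩, ?_⟩
  ext1 M
  rw [coeV, Finset.sum_apply, AddSubmonoidClass.coe_finsetSum, hδ]
  rfl

/-- The Lie derivative of a one-form on arbitrary functions, with its index raised. -/
def pLie (ξ χ : Param D) : Param D := fun M =>
  along ξ (χ M) + ∑ P, pd (bar M) (ξ P) * χ (bar P)

lemma coe_dAlong {𝒜 : Subalgebra ℝ (Fn D)} (h : IsDiffAlgebra 𝒜) (ξ : Idx D → 𝒜) (f : 𝒜) :
    (dAlong (pdDer h) ξ f : Fn D) = along (coeV ξ) f := by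
  rw [dAlong_apply, AddSubmonoidClass.coe_finsetSum]
  rfl

lemma coeV_dLie {𝒜 : Subalgebra ℝ (Fn D)} (h : IsDiffAlgebra 𝒜) (ξ χ : Idx D → 𝒜) :
    coeV (dLie (pdDer h) ξ χ) = pLie (coeV ξ) (coeV χ) := by
  ext1 M
  rw [coeV, dLie_apply, Subalgebra.coe_add, coe_dAlong, AddSubmonoidClass.coe_finsetSum]
  rfl

lemma coeV_dLie_iterate {𝒜 : Subalgebra ℝ (Fn D)} (h : IsDiffAlgebra 𝒜) (ξ χ : Idx D → 𝒜)
    (j : ℕ) : coeV ((dLie (pdDer h) ξ)^[j] χ) = (pLie (coeV ξ))^[j] (coeV χ) :=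
  Function.Semiconj.iterate_right (f := coeV) (fun χ => coeV_dLie h ξ χ) j χ

lemma coeV_add {𝒜 : Subalgebra ℝ (Fn D)} (v w : Idx D → 𝒜) : coeV (v + w) = coeV v + coeV w := rfl

lemma coeV_smul {𝒜 : Subalgebra ℝ (Fn D)} (c : ℝ) (v : Idx D → 𝒜) : coeV (c • v) = c • coeV v := rfl

lemma coeV_sum {𝒜 : Subalgebra ℝ (Fn D)} {ι : Type*} (s : Finset ι) (v : ι → Idx D → 𝒜) :
    coeV (∑ i ∈ s, v i) = ∑ i ∈ s, coeV (v i) := by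
  ext1 M
  rw [coeV, Finset.sum_apply, Finset.sum_apply, AddSubmonoidClass.coe_finsetSum]
  rfl

/-- A map of parameters agreeing on smooth parameters with a quasi-trivial one. -/
def IsSmoothlyQuasiTrivial (n : ℕ) (c : Param D → Param D) : Prop :=
  ∃ δ, IsQuasiTrivialOfOrder n δ ∧ ∀ ξ, IsSmooth ξ → δ ξ = c ξ

lemma IsQuasiTrivialOfOrder.smoothly {n : ℕ} {δ : Param D → Param D}
    (h : IsQuasiTrivialOfOrder n δ) : IsSmoothlyQuasiTrivial n δ := ⟨δ, h, fun _ _ => rfl⟩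

lemma IsSmoothlyQuasiTrivial.add {n : ℕ} {δ ε : Param D → Param D}
    (hδ : IsSmoothlyQuasiTrivial n δ) (hε : IsSmoothlyQuasiTrivial n ε) :
    IsSmoothlyQuasiTrivial n fun ξ => δ ξ + ε ξ := by
  obtain ⟨δ', h1, h2⟩ := hδ
  obtain ⟨ε', h3, h4⟩ := hε
  exact ⟨_, h1.add h3, fun ξ hξ => by rw [h2 ξ hξ, h4 ξ hξ]⟩

lemma IsSmoothlyQuasiTrivial.smul {n : ℕ} {δ : Param D → Param D}
    (hδ : IsSmoothlyQuasiTrivial n δ) (c : ℝ) : IsSmoothlyQuasiTrivial n fun ξ => c • δ ξ := by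
  obtain ⟨δ', h1, h2⟩ := hδ
  exact ⟨_, h1.smul c, fun ξ hξ => by rw [h2 ξ hξ]⟩

lemma IsSmoothlyQuasiTrivial.sum {ι : Type*} (s : Finset ι) {n : ℕ} {δ : ι → Param D → Param D}
    (h : ∀ i ∈ s, IsSmoothlyQuasiTrivial n (δ i)) :
    IsSmoothlyQuasiTrivial n fun ξ => ∑ i ∈ s, δ i ξ := by
  classical
  induction s using Finset.induction_on with
  | empty => exact (IsQuasiTrivialOfOrder.zero n).smoothly
  | insert a s ha ih =>
    simp only [sum_insert ha]
    exact (h a (mem_insert_self _ _)).add (ih fun i hi => h i (mem_insert_of_mem hi))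

/-- The Leibniz form of `𝓛_ξ (ρ dη)` is quasi-trivial of the next order. It is established for
smooth `ξ`, where the product rule and the symmetry of second derivatives are available; hence the
notion of agreement on smooth parameters. -/
lemma IsSmoothlyQuasiTrivial.lie {n : ℕ} {c : Param D → Param D}
    (hc : IsSmoothlyQuasiTrivial n c) :
    IsSmoothlyQuasiTrivial (n + 1) fun ξ => pLie ξ (c ξ) := by
  obtain ⟨δ, ⟨m, p, q, ρ, η, hp, hδ⟩, hc⟩ := hc
  have h1 : IsQuasiTrivialOfOrder (n + 1)
      (fun (ξ : Param D) M => ∑ i, along ξ (ρ i ξ) * pd (bar M) (η i ξ)) :=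
    ⟨m, fun i => p i + 1, q, fun i ξ => along ξ (ρ i ξ), η,
      fun i => ⟨by have := (hp i).1; beta_reduce; omega, (hp i).2.1.along, (hp i).2.2⟩, fun _ _ => rfl⟩
  have h2 : IsQuasiTrivialOfOrder (n + 1)
      (fun (ξ : Param D) M => ∑ i, ρ i ξ * pd (bar M) (along ξ (η i ξ))) :=
    ⟨m, p, fun i => q i + 1, ρ, fun i ξ => along ξ (η i ξ),
      fun i => ⟨by have := (hp i).1; beta_reduce; omega, (hp i).2.1, (hp i).2.2.along⟩, fun _ _ => rfl⟩
  refine ⟨_, h1.add h2, fun ξ hξ => ?_⟩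
  beta_reduce
  rw [← hc ξ hξ]
  -- The computation takes place among all smooth functions, which need not obey the strong
  -- constraint, so the result does not depend on a choice of `𝒜`.
  let h := isDiffAlgebra_smoothAlg (D := D)
  let ξ' : Idx D → smoothAlg D := fun M => ⟨ξ M, hξ M⟩
  let r : Fin m → smoothAlg D := fun i => ⟨ρ i ξ, (hp i).2.1.mem h hξ⟩
  let e : Fin m → smoothAlg D := fun i => ⟨η i ξ, (hp i).2.2.mem h hξ⟩
  have e0 : δ ξ = coeV (∑ i, fun M => r i * pdDer h (bar M) (e i)) := by
    rw [coeV_sum]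
    ext1 M
    rw [hδ, Finset.sum_apply]
    rfl
  have e1 : ξ = coeV ξ' := rfl
  rw [e0, e1, ← coeV_dLie h, map_sum, coeV_sum]
  ext1 M
  rw [Pi.add_apply, Finset.sum_apply, ← sum_add_distrib]
  refine sum_congr rfl fun i _ => ?_
  rw [dLie_mul_grad (pdDer_comm h)]
  simp only [coeV, Pi.add_apply, Subalgebra.coe_add, Subalgebra.coe_mul, coe_pdDer, coe_dAlong]
  rfl

lemma IsSmoothlyQuasiTrivial.lie_iterate {n : ℕ} {c : Param D → Param D}
    (hc : IsSmoothlyQuasiTrivial n c) (j : ℕ) :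
    IsSmoothlyQuasiTrivial (n + j) fun ξ => (pLie ξ)^[j] (c ξ) := by
  induction j with
  | zero => exact hc
  | succ j ih =>
    simp only [Function.iterate_succ_apply']
    exact ih.lie

/-- The coefficients of `ζ = X - X'` on arbitrary functions. -/
def pZeta (ξ : Param D) : ℕ → Param D
  | 0 => 0
  | n + 1 => fun M => adCoeff n • (along ξ)^[n] (ξ M)

lemma isDiffPoly_pZeta (n : ℕ) (M : Idx D) : IsDiffPoly n fun ξ => pZeta ξ n M := by
  rcases n with _ | n
  · exact .zero 0
  · refine IsDiffPoly.smul ?_ _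
    induction n with
    | zero => exact .comp M
    | succ n ih =>
      simp only [Function.iterate_succ_apply']
      exact ih.along

lemma coeV_zeta {𝒜 : Subalgebra ℝ (Fn D)} (h : IsDiffAlgebra 𝒜) (ξ : Idx D → 𝒜) (n : ℕ) :
    coeV (zeta (pdDer h) ξ n) = pZeta (coeV ξ) n := by
  rcases n with _ | n
  · rfl
  · ext1 M
    exact congrArg (adCoeff n • ·)
      (Function.Semiconj.iterate_right (f := Subtype.val) (fun f => coe_dAlong h ξ f) n (ξ M))

/-- The parameter `χ_n`. -/
def chiCoeff : ℕ → Param D → Param D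
  | 0 => fun _ => 0
  | n + 1 => fun ξ => ((n : ℝ) + 1)⁻¹ • ((1 / 2 : ℝ) • (fun M => ∑ K, pZeta ξ n K
      * pd (bar M) (ξ (bar K))) + (-1 : ℝ) • pLie ξ (chiCoeff n ξ))

lemma chiCoeff_smoothly (n : ℕ) : IsSmoothlyQuasiTrivial n (chiCoeff (D := D) n) := by
  induction n with
  | zero => exact (IsQuasiTrivialOfOrder.zero 0).smoothly
  | succ n ih =>
    refine .smul (.add (.smul (IsQuasiTrivialOfOrder.smoothly ?_) _) (.smul ih.lie _)) _
    exact .of_fintype (fun _ : Idx D => n) (fun _ => 1) (fun K ξ => pZeta ξ n K)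
      (fun K ξ => ξ (bar K)) (fun K => ⟨rfl, isDiffPoly_pZeta n K, .comp _⟩) fun _ _ => rfl

/-- The parameter `δ_n`. -/
def deltaCoeff (n : ℕ) (ξ : Param D) : Param D :=
  chiCoeff n ξ + ∑ j : Fin n, (-adCoeff (j + 1)) • (pLie ξ)^[j + 1] (deltaCoeff (n - (j + 1)) ξ)
  termination_by n
  decreasing_by omega

lemma deltaCoeff_smoothly (n : ℕ) : IsSmoothlyQuasiTrivial n (deltaCoeff (D := D) n) := by
  induction n using Nat.strong_induction_on with
  | _ n ih =>
    rw [show deltaCoeff n = _ from funext fun ξ => deltaCoeff.eq_1 (D := D) n ξ]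
    refine (chiCoeff_smoothly n).add (.sum _ fun j _ => .smul ?_ _)
    have := (ih (n - (j + 1)) (by omega)).lie_iterate (j + 1)
    rwa [show n - (j + 1) + (j + 1) = n by omega] at this

/-- The term `j = 0` is `δ_n` itself, with coefficient one; the recursive definition of `deltaCoeff`
moves the other terms, of lower order, to the other side. -/
lemma chiCoeff_eq_sum (n : ℕ) (ξ : Param D) :
    chiCoeff n ξ = ∑ j ∈ range (n + 1), adCoeff j • (pLie ξ)^[j] (deltaCoeff (n - j) ξ) := by
  rw [sum_range_succ', Nat.sub_zero, adCoeff_zero, one_smul, Function.iterate_zero, id,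
    deltaCoeff.eq_1 n ξ, ← Fin.sum_univ_eq_sum_range
      (fun j => adCoeff (j + 1) • (pLie ξ)^[j + 1] (deltaCoeff (n - (j + 1)) ξ)) n]
  simp only [neg_smul, sum_neg_distrib]
  abel

end QuasiTrivial

/-! ## Action of operator series on sequences -/

section Action

variable {E : Type*} [AddCommGroup E] [Module ℝ E]

/-- The action of a series of operators on a series of vectors, given by its coefficients. -/
def act (x : (Module.End ℝ E)⟦X⟧) (V : ℕ → E) : ℕ → E := fun n =>
  ∑ p ∈ antidiagonal n, coeff p.1 x (V p.2)

lemma act_one (V : ℕ → E) : act 1 V = V := by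
  ext1 n
  rw [act, Nat.sum_antidiagonal_eq_sum_range_succ_mk, sum_range_succ', sum_eq_zero]
  · simp
  · intro k _
    simp [coeff_one]

lemma act_mul (x y : (Module.End ℝ E)⟦X⟧) (V : ℕ → E) : act (x * y) V = act x (act y V) := by
  ext1 n
  simp only [act, coeff_mul, LinearMap.sum_apply, map_sum, Module.End.mul_apply]
  rw [sum_sigma', sum_sigma']
  refine sum_bij' (fun a _ => ⟨(a.2.1, a.2.2 + a.1.2), (a.2.2, a.1.2)⟩)
    (fun a _ => ⟨(a.1.1 + a.2.1, a.2.2), (a.1.1, a.2.1)⟩) ?_ ?_ ?_ ?_ ?_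
  · rintro ⟨⟨i, j⟩, ⟨k, l⟩⟩ h
    simp only [mem_sigma, HasAntidiagonal.mem_antidiagonal] at h ⊢
    exact ⟨by omega, trivial⟩
  · rintro ⟨⟨i, j⟩, ⟨k, l⟩⟩ h
    simp only [mem_sigma, HasAntidiagonal.mem_antidiagonal] at h ⊢
    exact ⟨by omega, trivial⟩
  · rintro ⟨⟨i, j⟩, ⟨k, l⟩⟩ h
    simp only [mem_sigma, HasAntidiagonal.mem_antidiagonal] at h
    obtain ⟨_, rfl⟩ := h
    rfl
  · rintro ⟨⟨i, j⟩, ⟨k, l⟩⟩ h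
    simp only [mem_sigma, HasAntidiagonal.mem_antidiagonal] at h
    obtain ⟨_, rfl⟩ := h
    rfl
  · rintro ⟨⟨i, j⟩, ⟨k, l⟩⟩ _
    rfl

lemma coeff_pow_eq_zero {B : Type*} [Semiring B] {x : B⟦X⟧} (h0 : coeff 0 x = 0) {n k : ℕ}
    (h : n < k) : coeff n (x ^ k) = 0 := by
  induction k generalizing n with
  | zero => omega
  | succ k ih =>
    rw [pow_succ, coeff_mul]
    refine sum_eq_zero fun p hp => ?_
    have hp := HasAntidiagonal.mem_antidiagonal.1 hp
    rcases Nat.lt_or_ge p.1 k with h1 | h1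
    · rw [ih h1, zero_mul]
    · rw [show p.2 = 0 by omega, h0, mul_zero]

/-- Reconciles two cutoffs: `pexp` truncates at the order of the operator coefficient, `fexp` at the
total order. The surplus powers contribute nothing, as `x` has no constant term. -/
lemma act_pexp {x : (Module.End ℝ E)⟦X⟧} (h0 : coeff 0 x = 0) (V : ℕ → E) (n : ℕ) :
    act (pexp x) V n = ∑ k ∈ range (n + 1), ((k.factorial : ℝ)⁻¹) • act (x ^ k) V n := by
  have e : ∀ p ∈ antidiagonal n, coeff p.1 (pexp x) (V p.2)
      = ∑ k ∈ range (n + 1), ((k.factorial : ℝ)⁻¹) • (coeff p.1 (x ^ k)) (V p.2) := by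
    intro p hp
    have hp := HasAntidiagonal.mem_antidiagonal.1 hp
    rw [pexp, coeff_mk, LinearMap.sum_apply]
    refine sum_subset (range_subset_range.2 (by omega)) fun k _ hk => ?_
    have hz : coeff p.1 (x ^ k) = 0 := coeff_pow_eq_zero h0 (by simpa using hk)
    rw [LinearMap.smul_apply, hz, LinearMap.zero_apply, smul_zero]
  rw [act, sum_congr rfl e, sum_comm]
  exact sum_congr rfl fun k _ => smul_sum.symm

end Action

/-! ## Comparison with formal vectors of functions -/

section Transfer

variable {D : ℕ} {𝒜 : Subalgebra ℝ (Fn D)}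

/-- The formal vector with given coefficients. -/
def incl (V : ℕ → Idx D → 𝒜) : FVec D := fun M => PowerSeries.mk fun n => (V n M : Fn D)

lemma coeff_incl (V : ℕ → Idx D → 𝒜) (M : Idx D) (n : ℕ) :
    coeff n (incl V M) = (V n M : Fn D) := coeff_mk _ _

lemma exists_incl_eq (V : FVec D) (h : ∀ M n, (V M).coeff n ∈ 𝒜) :
    ∃ V' : ℕ → Idx D → 𝒜, incl V' = V :=
  ⟨fun n M => ⟨_, h M n⟩, by ext M n : 2; rw [coeff_incl]⟩

lemma fexp_incl {T : FVec D → FVec D} {x : (Module.End ℝ (Idx D → 𝒜))⟦X⟧} (h0 : coeff 0 x = 0)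
    (h : ∀ V : ℕ → Idx D → 𝒜, T (incl V) = incl (act x V)) (V : ℕ → Idx D → 𝒜) :
    fexp T (incl V) = incl (act (pexp x) V) := by
  have hk : ∀ k, T^[k] (incl V) = incl (act (x ^ k) V) := by
    intro k
    induction k with
    | zero => rw [pow_zero, act_one]; rfl
    | succ k ih => rw [Function.iterate_succ_apply', ih, h, pow_succ', act_mul]
  ext M n : 2
  rw [fexp, coeff_mk, coeff_incl]
  rw [act_pexp h0, Finset.sum_apply, AddSubmonoidClass.coe_finsetSum]
  refine sum_congr rfl fun k _ => ?_
  rw [hk, coeff_incl]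
  rfl

/-- The operator series of `Ξ^P ∂_P` for a formal parameter. -/
def alongSer (d : Idx D → Derivation ℝ 𝒜 𝒜) (Ξ : ℕ → Idx D → 𝒜) :
    (Module.End ℝ (Idx D → 𝒜))⟦X⟧ := PowerSeries.mk fun n => alongOp d (Ξ n)

lemma transport_incl (h : IsDiffAlgebra 𝒜) (Ξ V : ℕ → Idx D → 𝒜) :
    transport (incl Ξ) (incl V) = incl (act (alongSer (pdDer h) Ξ) V) := by
  ext M n : 2
  rw [coeff_incl]
  simp only [transport, map_sum, coeff_mul, fpd, coeff_mk, coeff_incl, act, alongSer,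
    Finset.sum_apply, alongOp_apply, dAlong_apply, AddSubmonoidClass.coe_finsetSum]
  rw [sum_comm]
  rfl

lemma genLie_incl (h : IsDiffAlgebra 𝒜) (Ξ V : ℕ → Idx D → 𝒜) :
    genLie (incl Ξ) (incl V) = incl (act (lieSer (pdDer h) Ξ) V) := by
  ext M n : 2
  rw [coeff_incl]
  simp only [genLie, map_add, map_sub, map_sum, coeff_mul, fpd, coeff_mk, coeff_incl, act, lieSer,
    lieOp, LinearMap.add_apply, Pi.add_apply, matOp_apply, Matrix.mulVec, dotProduct, dSkew_apply,
    Finset.sum_apply, alongOp_apply, dAlong_apply, AddSubmonoidClass.coe_finsetSum,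
    Subalgebra.coe_add, sum_add_distrib]
  congr 1 <;> rw [sum_comm] <;> rfl

lemma act_neg (x : (Module.End ℝ (Idx D → 𝒜))⟦X⟧) (V : ℕ → Idx D → 𝒜) :
    incl (act (-x) V) = -incl (act x V) := by
  ext M n : 2
  rw [Pi.neg_apply, map_neg, coeff_incl, coeff_incl]
  simp only [act, map_neg, LinearMap.neg_apply, sum_neg_distrib]
  rfl

lemma lieOp_zero (d : Idx D → Derivation ℝ 𝒜 𝒜) : lieOp d 0 = 0 := by
  refine LinearMap.ext fun v => ?_
  ext1 M
  simp [lieOp, alongOp_apply, dAlong_apply, dSkew_zero]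

lemma alongOp_zero (d : Idx D → Derivation ℝ 𝒜 𝒜) : alongOp d 0 = 0 := by
  refine LinearMap.ext fun v => ?_
  ext1 M
  simp [alongOp_apply, dAlong_apply]

lemma genG_incl (h : IsDiffAlgebra 𝒜) (Ξ V : ℕ → Idx D → 𝒜) (h0 : Ξ 0 = 0) :
    genG (incl Ξ) (incl V)
      = incl (act (pexp (-alongSer (pdDer h) Ξ) * pexp (lieSer (pdDer h) Ξ)) V) := by
  have h1 : coeff 0 (lieSer (pdDer h) Ξ) = 0 := by rw [coeff_lieSer, h0, lieOp_zero]
  have h2 : coeff 0 (-alongSer (pdDer h) Ξ) = 0 := by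
    rw [map_neg, alongSer, coeff_mk, h0, alongOp_zero]
    exact neg_zero (G := Module.End ℝ (Idx D → 𝒜))
  rw [genG, fexp_incl h1 (genLie_incl h Ξ), fexp_incl h2, act_mul]
  intro W
  rw [transport_incl h, act_neg]

/-- The inclusion of matrices of formal power series. -/
def inclMat : Matrix (Idx D) (Idx D) 𝒜⟦X⟧ →+* FMat D :=
  (PowerSeries.map 𝒜.val.toRingHom).mapMatrix

lemma coeff_inclMat (A : Matrix (Idx D) (Idx D) 𝒜⟦X⟧) (M N : Idx D) (n : ℕ) :
    coeff n (inclMat A M N) = ((coeff n (A M N) : 𝒜) : Fn D) := rfl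

lemma inclMat_mulVec (A : Matrix (Idx D) (Idx D) 𝒜⟦X⟧) (V : ℕ → Idx D → 𝒜) :
    (inclMat A).mulVec (incl V) = incl (act (serOp A) V) := by
  ext M n : 2
  rw [coeff_incl]
  simp only [Matrix.mulVec, dotProduct, map_sum, coeff_mul, coeff_inclMat, coeff_incl, act,
    coeff_serOp, matOp_apply, Finset.sum_apply, AddSubmonoidClass.coe_finsetSum, Matrix.map_apply]
  rw [sum_comm]
  rfl

lemma etaTr_inclMat (A : Matrix (Idx D) (Idx D) 𝒜⟦X⟧) :
    etaTr (inclMat A) = inclMat (etaTr A) := rfl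

lemma inclMat_smul (c : ℝ) (A : Matrix (Idx D) (Idx D) 𝒜⟦X⟧) :
    inclMat (c • A) = c • inclMat A := by
  ext M N n : 3
  rw [Matrix.smul_apply, coeff_smul, coeff_inclMat, coeff_inclMat, Matrix.smul_apply, coeff_smul]
  rfl

end Transfer

/-! ### Evaluation of `𝒢` and `ℱ` at the rescaled parameters -/

section Rescaled

variable {D : ℕ} {𝒜 : Subalgebra ℝ (Fn D)}

/-- The coefficients of `λ ξ + ∑ n, λ^n δ_n`. -/
def shifted (ξ : Idx D → 𝒜) (δ : ℕ → Idx D → 𝒜) (n : ℕ) : Idx D → 𝒜 :=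
  (if n = 1 then ξ else 0) + δ n

lemma scaled_add_series_eq (ξ : Idx D → 𝒜) {δ : ℕ → Idx D → 𝒜} {δ' : ℕ → Param D → Param D}
    (h : ∀ n, coeV (δ n) = δ' n (coeV ξ)) :
    scaled (coeV ξ) + series δ' (coeV ξ) = incl (shifted ξ δ) := by
  ext M n : 2
  rw [coeff_incl, Pi.add_apply, map_add, series, coeff_mk, ← h, scaled, (commute_X _).symm.eq,
    ← pow_one X, coeff_C_mul_X_pow, shifted]
  split_ifs <;> rfl

lemma scaled_eq_incl (ξ : Idx D → 𝒜) : scaled (coeV ξ) = incl (shifted ξ 0) := by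
  rw [← scaled_add_series_eq ξ (δ' := 0) fun n => rfl]
  ext M n : 2
  rw [Pi.add_apply, map_add, series, coeff_mk]
  exact (add_zero _).symm

lemma series_eq_incl (ξ : Idx D → 𝒜) {δ : ℕ → Idx D → 𝒜} {δ' : ℕ → Param D → Param D}
    (h : ∀ n, coeV (δ n) = δ' n (coeV ξ)) : series δ' (coeV ξ) = incl δ := by
  ext M n : 2
  rw [coeff_incl, series, coeff_mk, ← h]
  rfl

lemma alongOp_add (d : Idx D → Derivation ℝ 𝒜 𝒜) (ξ χ : Idx D → 𝒜) :
    alongOp d (ξ + χ) = alongOp d ξ + alongOp d χ := by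
  refine LinearMap.ext fun v => ?_
  ext1 M
  simp only [LinearMap.add_apply, Pi.add_apply, alongOp_apply, dAlong_apply, add_mul,
    sum_add_distrib]

lemma lieOp_add (d : Idx D → Derivation ℝ 𝒜 𝒜) (ξ χ : Idx D → 𝒜) :
    lieOp d (ξ + χ) = lieOp d ξ + lieOp d χ := by
  rw [lieOp, lieOp, lieOp, alongOp_add, dSkew_add, map_add]
  abel

lemma coeff_X_mul_C {B : Type*} [Semiring B] (b : B) (n : ℕ) :
    coeff n (X * C b) = if n = 1 then b else 0 := by
  rw [← (commute_X (C b)).eq, ← pow_one X, coeff_C_mul_X_pow]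

lemma lieSer_shifted (d : Idx D → Derivation ℝ 𝒜 𝒜) (ξ : Idx D → 𝒜) (δ : ℕ → Idx D → 𝒜) :
    lieSer d (shifted ξ δ) = X * C (lieOp d ξ) + lieSer d δ := by
  ext1 n
  rw [map_add, coeff_lieSer, coeff_lieSer, coeff_X_mul_C, shifted, lieOp_add]
  split_ifs
  · rfl
  · rw [lieOp_zero]

/-- A quasi-trivial shift does not transport functions, so `ξ'` and `λξ` have the same factor `e^{-λ
ξ^P ∂_P}`. -/
lemma alongSer_shifted (h : IsFieldAlgebra 𝒜) (ξ : Idx D → 𝒜) {δ : ℕ → Idx D → 𝒜}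
    (hδ : ∀ n, δ n ∈ quasi (pdDer h.isDiffAlgebra)) :
    -alongSer (pdDer h.isDiffAlgebra) (shifted ξ δ)
      = X * C (-alongOp (pdDer h.isDiffAlgebra) ξ) := by
  ext1 n
  rw [map_neg, coeff_X_mul_C, alongSer, coeff_mk, shifted, alongOp_add,
    alongOp_eq_zero (pdDer_strong h) (hδ n), add_zero]
  split_ifs
  · rfl
  · rw [alongOp_zero]
    exact neg_zero (G := Module.End ℝ (Idx D → 𝒜))

lemma alongSer_quasi (h : IsFieldAlgebra 𝒜) {δ : ℕ → Idx D → 𝒜}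
    (hδ : ∀ n, δ n ∈ quasi (pdDer h.isDiffAlgebra)) :
    -alongSer (pdDer h.isDiffAlgebra) δ = 0 := by
  ext1 n
  rw [map_neg, alongSer, coeff_mk, alongOp_eq_zero (pdDer_strong h) (hδ n)]
  exact neg_zero (G := Module.End ℝ (Idx D → 𝒜))

lemma genG_scaled (h : IsFieldAlgebra 𝒜) (ξ : Idx D → 𝒜) (V : ℕ → Idx D → 𝒜) :
    genG (scaled (coeV ξ)) (incl V) = incl (act (serG (pdDer h.isDiffAlgebra) ξ) V) := by
  have h0 : lieSer (pdDer h.isDiffAlgebra) (0 : ℕ → Idx D → 𝒜) = 0 := by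
    ext1 n
    rw [coeff_lieSer, Pi.zero_apply, lieOp_zero, map_zero]
  rw [scaled_eq_incl, genG_incl h.isDiffAlgebra _ _ (by simp [shifted]), lieSer_shifted,
    alongSer_shifted h ξ (δ := 0) fun _ => zero_mem _, h0, add_zero, serG]

lemma genG_series (h : IsFieldAlgebra 𝒜) {χ : ℕ → Idx D → 𝒜}
    (hχ : ∀ n, χ n ∈ quasi (pdDer h.isDiffAlgebra)) (h0 : χ 0 = 0) (V : ℕ → Idx D → 𝒜) :
    genG (incl χ) (incl V) = incl (act (1 + lieSer (pdDer h.isDiffAlgebra) χ) V) := by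
  rw [genG_incl h.isDiffAlgebra _ _ h0, alongSer_quasi h hχ, pexp_zero, one_mul,
    pexp_lieSer (pdDer_comm _) (pdDer_strong h) hχ h0]

lemma genG_shifted (h : IsFieldAlgebra 𝒜) {ξ : Idx D → 𝒜} {χ δ : ℕ → Idx D → 𝒜}
    (hχ : ∀ n, χ n ∈ quasi (pdDer h.isDiffAlgebra))
    (hδ : ∀ n, δ n ∈ quasi (pdDer h.isDiffAlgebra)) (h0 : δ 0 = 0)
    (hr : DeltaRec (pdDer h.isDiffAlgebra) ξ χ δ) (V : ℕ → Idx D → 𝒜) :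
    genG (incl (shifted ξ δ)) (incl V)
      = incl (act (serG (pdDer h.isDiffAlgebra) ξ
          * (1 + lieSer (pdDer h.isDiffAlgebra) χ)) V) := by
  rw [genG_incl h.isDiffAlgebra _ _ (by simp [shifted, h0]), lieSer_shifted,
    alongSer_shifted h ξ hδ, hr.pexp_add (pdDer_comm _) (pdDer_strong h) hχ hδ h0, serG, mul_assoc]

/-! ### The transformed coordinates -/

lemma transport_X_pow (ξ v : Param D) (k : ℕ) :
    -transport (scaled ξ) (fun M => X ^ k * C (v M))
      = fun M => X ^ (k + 1) * C ((-along ξ) (v M)) := by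
  ext M n : 2
  have h : ∀ P, scaled ξ P * fpd P (X ^ k * C (v M)) = X ^ (k + 1) * C (ξ P * pd P (v M)) := by
    intro P
    have : fpd P (X ^ k * C (v M)) = X ^ k * C (pd P (v M)) := by
      ext1 m
      rw [fpd, coeff_mk, coeff_X_pow_mul', coeff_X_pow_mul', coeff_C, coeff_C]
      split_ifs <;> first | rfl | exact pd_zero P
    rw [this, scaled, map_mul, pow_succ]
    ring
  simp only [transport, Pi.neg_apply, h, ← mul_sum, ← map_sum, map_neg, mul_neg]
  rfl

/-- The coordinates need not belong to `𝒜`, so the exponential acting on them is expanded directly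
on functions. -/
lemma coeff_newCoord (ξ : Param D) (M : Idx D) (n : ℕ) :
    coeff n (newCoord (scaled ξ) M)
      = ((n.factorial : ℝ)⁻¹) • (-along ξ)^[n] (fun x => x M) := by
  have hk : ∀ k, (fun W => -transport (scaled ξ) W)^[k] (coord D)
      = fun M => X ^ k * C ((-along ξ)^[k] (fun x => x M)) := by
    intro k
    induction k with
    | zero => ext1 M; simp [coord]
    | succ k ih =>
      rw [Function.iterate_succ_apply', ih, transport_X_pow]
      simp only [Function.iterate_succ_apply']
  rw [newCoord, fexp, coeff_mk]
  simp only [hk, coeff_X_pow_mul', coeff_C]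
  rw [sum_eq_single n]
  · simp
  · intro k hk hkn
    have : k < n := by have := mem_range.1 hk; omega
    rw [if_pos this.le, if_neg (by omega), smul_zero]
  · simp

lemma pd_coord (M N : Idx D) : pd M (fun x => x N) = fun _ => if M = N then 1 else 0 := by
  ext x
  have : (fun x : Space D => x N) = ContinuousLinearMap.proj (R := ℝ) (φ := fun _ => ℝ) N := rfl
  rw [pd, this, ContinuousLinearMap.fderiv]
  simp [Pi.single_apply, eq_comm]

lemma along_coord (ξ : Param D) (M : Idx D) : along ξ (fun x => x M) = ξ M := by
  simp only [along, pd_coord]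
  ext x
  simp

lemma neg_along_iterate (h : IsDiffAlgebra 𝒜) (ξ : Idx D → 𝒜) (f : 𝒜) (n : ℕ) :
    (-along (coeV ξ))^[n] (f : Fn D)
      = (((-1 : ℝ) ^ n • (dAlong (pdDer h) ξ)^[n] f : 𝒜) : Fn D) := by
  induction n with
  | zero => simp
  | succ n ih =>
    rw [Function.iterate_succ_apply', Function.iterate_succ_apply', ih, Pi.neg_apply,
      ← coe_dAlong h, Derivation.map_smul, pow_succ, mul_neg_one, neg_smul]
    rfl

lemma coeff_coord_sub_newCoord (h : IsDiffAlgebra 𝒜) (ξ : Idx D → 𝒜) (M : Idx D) (n : ℕ) :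
    coeff n (coord D M - newCoord (scaled (coeV ξ)) M)
      = ((zeta (pdDer h) ξ n M : 𝒜) : Fn D) := by
  rw [map_sub, coeff_newCoord, coord, coeff_C]
  rcases n with _ | n
  · simp [zeta]
  · rw [if_neg n.succ_ne_zero, zero_sub, Function.iterate_succ_apply, Pi.neg_apply, along_coord]
    -- One application of `-ξ^P ∂_P` to `X^M` gives `-ξ^M`, which lies in `𝒜`; the remaining `n`
    -- applications stay there, and the sign and factorial combine to `adCoeff n`.
    have e2 := neg_along_iterate h ξ (-ξ M) n
    rw [iterate_map_neg] at e2
    have e3 : -coeV ξ M = ((-ξ M : 𝒜) : Fn D) := rfl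
    rw [e3, e2, zeta, adCoeff, smul_neg]
    beta_reduce
    rw [mul_comm, mul_smul, NegMemClass.coe_neg, smul_neg, neg_neg]
    rfl

lemma matA_scaled (h : IsDiffAlgebra 𝒜) (ξ : Idx D → 𝒜) :
    matA (scaled (coeV ξ)) = inclMat (serA (pdDer h) ξ) := by
  ext M N n : 3
  rw [coeff_inclMat, matA, Matrix.of_apply, fpd, coeff_mk, coeff_coord_sub_newCoord h, serA, fGrad,
    Matrix.of_apply, coeff_mk, coeff_mk]
  rfl

lemma newCoord_jacobian (h : IsDiffAlgebra 𝒜) (ξ : Idx D → 𝒜) :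
    Matrix.of (fun M N => fpd M (newCoord (scaled (coeV ξ)) N))
      = inclMat (serJ (pdDer h) ξ) := by
  rw [serJ, map_sub, map_one, ← matA_scaled h]
  ext M N n : 3
  rw [Matrix.of_apply, Matrix.sub_apply, map_sub, matA, Matrix.of_apply, fpd, coeff_mk, fpd,
    coeff_mk, map_sub, coord, coeff_C, Matrix.one_apply]
  rcases n with _ | n
  · rw [coeff_newCoord]
    simp [pd_coord, pd_zero]
    split_ifs <;> rfl
  · rw [if_neg n.succ_ne_zero, zero_sub, pd_neg]
    split_ifs <;> simp [coeff_one]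

lemma matB_scaled (h : IsDiffAlgebra 𝒜) (ξ : Idx D → 𝒜) :
    matB (scaled (coeV ξ)) = inclMat (serJ (pdDer h) ξ)⁻¹ := by
  rw [matB, newCoord_jacobian h]
  refine Matrix.inv_eq_right_inv ?_
  rw [← map_mul, Matrix.mul_nonsing_inv _ (isUnit_det_serJ _ ξ), map_one]

lemma genF_scaled (h : IsDiffAlgebra 𝒜) (ξ : Idx D → 𝒜) :
    genF (scaled (coeV ξ)) = inclMat (serF (pdDer h) ξ) := by
  have e : (etaTr (matB (scaled (coeV ξ))))⁻¹ = inclMat (etaTr (serJ (pdDer h) ξ)) := by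
    refine Matrix.inv_eq_right_inv ?_
    rw [matB_scaled h, etaTr_inclMat, ← map_mul, ← etaTr_mul,
      Matrix.mul_nonsing_inv _ (isUnit_det_serJ _ ξ), etaTr_one, map_one]
  rw [genF, e, matB_scaled h, serF, inclMat_smul, map_add, map_mul, map_mul]

end Rescaled

/-! ### Transfer of the equations to functions, and the universal sequences -/

section Final

variable {D : ℕ} {𝒜 : Subalgebra ℝ (Fn D)}

lemma matOp_injective {R : Type*} [CommRing R] [Algebra ℝ R] :
    Function.Injective (matOp : Matrix (Idx D) (Idx D) R → Module.End ℝ (Idx D → R)) := by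
  intro A B h
  ext M N
  have := congrFun (LinearMap.congr_fun h (Pi.single N 1)) M
  rw [matOp_apply, matOp_apply, Matrix.mulVec_single_one, Matrix.mulVec_single_one] at this
  exact this

lemma gradMat_coeV (h : IsDiffAlgebra 𝒜) (ξ : Idx D → 𝒜) :
    (gradMat (coeV ξ)).map C = inclMat ((dGrad (pdDer h) ξ).map C) := by
  ext M N n : 3
  rw [coeff_inclMat, Matrix.map_apply, Matrix.map_apply, coeff_C, coeff_C]
  split_ifs <;> rfl

lemma inclMat_map_flow (h : IsDiffAlgebra 𝒜) (ξ : Idx D → 𝒜)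
    (A : Matrix (Idx D) (Idx D) 𝒜⟦X⟧) :
    inclMat (A.map (flow (pdDer h) ξ)) = (inclMat A).map (PowerSeries.derivative (Fn D))
      + (inclMat A).map fun φ => ∑ P, C (coeV ξ P) * fpd P φ := by
  ext M N n : 3
  simp only [coeff_inclMat, Matrix.map_apply, flow_apply, map_add, coeff_derivative, coeff_fAlong,
    Matrix.add_apply, Subalgebra.coe_add, coe_dAlong, map_sum, coeff_C_mul, fpd, coeff_mk]
  rfl

lemma solvesODE_genF (h : IsFieldAlgebra 𝒜) (ξ : Idx D → 𝒜) :
    SolvesODE (coeV ξ) (genF (scaled (coeV ξ))) := by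
  have hd := h.isDiffAlgebra
  rw [genF_scaled hd]
  refine ⟨?_, ?_⟩
  · have h1 : (serF (pdDer hd) ξ).map (coeff 0) = 1 :=
      matOp_injective (by rw [← coeff_serOp, coeff_zero_serF, map_one])
    refine Matrix.ext fun M N => ?_
    rw [Matrix.map_apply, ← coeff_zero_eq_constantCoeff_apply, coeff_inclMat]
    have h2 : coeff 0 (serF (pdDer hd) ξ M N) = (1 : Matrix (Idx D) (Idx D) 𝒜) M N :=
      congrFun (congrFun h1 M) N
    rw [h2, Matrix.one_apply, Matrix.one_apply]
    split_ifs <;> rfl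
  · have h1 := congrArg inclMat (serF_flow (pdDer_comm hd) (pdDer_strong h) ξ)
    rw [inclMat_map_flow, map_add, inclMat_smul, map_mul, map_mul, map_sub, map_sub, map_mul,
      map_mul, ← etaTr_inclMat, ← etaTr_inclMat, ← gradMat_coeV, ← matB_scaled, ← matA_scaled] at h1
    rw [add_assoc, ← h1]
    abel

lemma recursion_of_chiRec (h : IsDiffAlgebra 𝒜) {ξ : Idx D → 𝒜} {χ : ℕ → Idx D → 𝒜}
    (hr : ChiRec (pdDer h) ξ χ) : Recursion (coeV ξ) fun n => coeV (χ n) := by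
  intro n
  have h1 := congrArg (𝒜.val.toRingHom.mapMatrix) (hr.dSkew_eq (pdDer_comm h) n)
  have hA : (matA (scaled (coeV ξ))).map (coeff n)
      = 𝒜.val.toRingHom.mapMatrix (dGrad (pdDer h) (zeta (pdDer h) ξ n)) := by
    rw [matA_scaled h, ← coeff_serA]
    rfl
  have hs : ∀ v, skewGrad (coeV v) = 𝒜.val.toRingHom.mapMatrix (dSkew (pdDer h) v) :=
    fun v => rfl
  have ha : gradMat (coeV ξ) = 𝒜.val.toRingHom.mapMatrix (dGrad (pdDer h) ξ) := rfl
  have ht : ∀ A : Matrix (Idx D) (Idx D) 𝒜, etaTr (𝒜.val.toRingHom.mapMatrix A)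
      = 𝒜.val.toRingHom.mapMatrix (etaTr A) := fun A => rfl
  have hl : (skewGrad (coeV (χ n))).map (along (coeV ξ)) = 𝒜.val.toRingHom.mapMatrix
      ((dSkew (pdDer h) (χ n)).map (dAlong (pdDer h) ξ)) := by
    refine Matrix.ext fun M N => ?_
    exact (coe_dAlong h ξ (dSkew (pdDer h) (χ n) M N)).symm
  have hsm : ∀ (c : ℝ) (A : Matrix (Idx D) (Idx D) 𝒜), 𝒜.val.toRingHom.mapMatrix (c • A)
      = c • 𝒜.val.toRingHom.mapMatrix A := fun c A => rfl
  rw [map_add, map_add, map_add, hsm, hsm, map_sub, map_mul, map_mul, map_mul, map_mul, ← ht, ← ht,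
    ← hA, ← ha, ← hl, ← hs, ← hs] at h1
  exact h1

/-- Quasi-trivial sequences agreeing on smooth parameters with a given one. -/
lemma exists_quasiTrivial_seq {c : ℕ → Param D → Param D}
    (hc : ∀ n, IsSmoothlyQuasiTrivial n (c n)) (h0 : ∀ ξ, c 0 ξ = 0) :
    ∃ δ : ℕ → Param D → Param D, δ 0 = 0 ∧ (∀ n, IsQuasiTrivialOfOrder n (δ n)) ∧
      ∀ n ξ, IsSmooth ξ → δ n ξ = c n ξ := by
  choose δ h1 h2 using hc
  -- The term of order zero is reset so that it vanishes on all parameters, not only on smooth ones.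
  refine ⟨fun n => if n = 0 then 0 else δ n, rfl, fun n => ?_, fun n ξ hξ => ?_⟩
  · beta_reduce
    split_ifs with hn
    · exact .zero n
    · exact h1 n
  · beta_reduce
    split_ifs with hn
    · rw [hn, h0]; rfl
    · exact h2 n ξ hξ

/-- The constant basis vectors have coefficients in `𝒜`, so the operator identity applies to them
and determines every column. -/
lemma genGMat_eq {Ξ : FVec D} {F : FMat D}
    (hF : ∀ V : FVec D, (∀ M n, (V M).coeff n ∈ 𝒜) → genG Ξ V = F.mulVec V) : genGMat Ξ = F := by
  refine Matrix.ext fun M N => ?_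
  rw [genGMat, Matrix.of_apply, hF, Matrix.mulVec_single_one]
  · rfl
  · intro K n
    rw [Pi.single_apply]
    split_ifs
    · rw [coeff_one]
      split_ifs
      · exact one_mem _
      · exact zero_mem _
    · rw [map_zero]; exact zero_mem _

lemma chiCoeff_rec (h : IsDiffAlgebra 𝒜) {ξ : Idx D → 𝒜} {χ : ℕ → Idx D → 𝒜}
    (hχ : ∀ n, coeV (χ n) = chiCoeff n (coeV ξ)) : ChiRec (pdDer h) ξ χ := by
  intro n
  apply coeV_injective
  have e : coeV (fun M => ∑ K, zeta (pdDer h) ξ n K * pdDer h (bar M) (ξ (bar K)))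
      = fun M => ∑ K, pZeta (coeV ξ) n K * pd (bar M) (coeV ξ (bar K)) := by
    rw [← coeV_zeta h]
    ext1 M
    rw [coeV, AddSubmonoidClass.coe_finsetSum]
    rfl
  have hn : ((n : ℝ) + 1) ≠ 0 := by positivity
  rw [coeV_add, coeV_smul, coeV_smul, coeV_dLie, e, hχ, hχ, chiCoeff, smul_smul,
    mul_inv_cancel₀ hn, one_smul, neg_one_smul]
  abel

lemma deltaCoeff_rec (h : IsDiffAlgebra 𝒜) {ξ : Idx D → 𝒜} {χ δ : ℕ → Idx D → 𝒜}
    (hχ : ∀ n, coeV (χ n) = chiCoeff n (coeV ξ)) (hδ : ∀ n, coeV (δ n) = deltaCoeff n (coeV ξ)) :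
    DeltaRec (pdDer h) ξ χ δ := by
  intro n
  apply coeV_injective
  rw [hχ, chiCoeff_eq_sum, coeV_sum]
  refine sum_congr rfl fun j _ => ?_
  rw [coeV_smul, coeV_dLie_iterate, hδ]

end Final

end DFT

end

theorem mainTheorem2 (D : ℕ) :
    ∃ δ χ : ℕ → DFT.Param D → DFT.Param D,
      δ 0 = 0 ∧ χ 0 = 0 ∧
      (∀ n, DFT.IsQuasiTrivialOfOrder n (δ n)) ∧
      (∀ n, DFT.IsQuasiTrivialOfOrder n (χ n)) ∧
      ∀ 𝒜 : Subalgebra ℝ (DFT.Fn D), DFT.IsFieldAlgebra 𝒜 →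
      ∀ ξ : DFT.Param D, (∀ M, ξ M ∈ 𝒜) →
        (∀ V : DFT.FVec D, (∀ M n, (V M).coeff n ∈ 𝒜) →
          DFT.genG (DFT.scaled ξ + DFT.series δ ξ) V
              = (DFT.genF (DFT.scaled ξ)).mulVec V ∧
          DFT.genG (DFT.scaled ξ + DFT.series δ ξ) V
              = DFT.genG (DFT.scaled ξ) (DFT.genG (DFT.series χ ξ) V)) ∧
        DFT.Recursion ξ (fun n => χ n ξ) ∧
        DFT.SolvesODE ξ (DFT.genF (DFT.scaled ξ)) ∧
        DFT.SolvesODE ξ (DFT.genGMat (DFT.scaled ξ + DFT.series δ ξ)) := by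
  open DFT in
  obtain ⟨χ, hχ0, hχ, hχc⟩ :=
    exists_quasiTrivial_seq (chiCoeff_smoothly (D := D)) fun _ => rfl
  obtain ⟨δ, hδ0, hδ, hδc⟩ := exists_quasiTrivial_seq (deltaCoeff_smoothly (D := D))
    fun ξ => by rw [deltaCoeff]; simp [chiCoeff]
  refine ⟨δ, χ, hδ0, hχ0, hδ, hχ, fun 𝒜 h ξ₀ hξ => ?_⟩
  have hd := h.isDiffAlgebra
  have hsm : IsSmooth ξ₀ := fun M => h.smooth _ (hξ M)
  obtain ⟨ξ, rfl⟩ : ∃ ξ : Idx D → 𝒜, coeV ξ = ξ₀ := ⟨fun M => ⟨ξ₀ M, hξ M⟩, rfl⟩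
  -- The universal sequences are evaluated at `ξ` and lifted to `𝒜`, where they lie in `quasi` and
  -- the strong constraint can be used.
  choose χ' hχq hχ' using fun n => (hχ n).exists_mem_quasi hd hξ
  choose δ' hδq hδ' using fun n => (hδ n).exists_mem_quasi hd hξ
  have hχz : χ' 0 = 0 := coeV_injective (by rw [hχ', hχ0]; rfl)
  have hδz : δ' 0 = 0 := coeV_injective (by rw [hδ', hδ0]; rfl)
  have hχ'' : ∀ n, coeV (χ' n) = chiCoeff n (coeV ξ) := fun n => by rw [hχ', hχc n _ hsm]
  have hδ'' : ∀ n, coeV (δ' n) = deltaCoeff n (coeV ξ) := fun n => by rw [hδ', hδc n _ hsm]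
  have hcr := chiCoeff_rec hd hχ''
  have hdr := deltaCoeff_rec hd hχ'' hδ''
  have hG : ∀ V : FVec D, (∀ M n, (V M).coeff n ∈ 𝒜) →
      genG (scaled (coeV ξ) + series δ (coeV ξ)) V
        = (genF (scaled (coeV ξ))).mulVec V := by
    intro V hV
    obtain ⟨V, rfl⟩ := exists_incl_eq V hV
    rw [scaled_add_series_eq ξ hδ', genG_shifted h hχq hδq hδz hdr, genF_scaled hd,
      inclMat_mulVec, hcr.serG_mul (pdDer_comm hd) (pdDer_strong h) hχq hχz]
  refine ⟨fun V hV => ⟨hG V hV, ?_⟩, ?_, solvesODE_genF h ξ, ?_⟩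
  · obtain ⟨V, rfl⟩ := exists_incl_eq V hV
    rw [scaled_add_series_eq ξ hδ', genG_shifted h hχq hδq hδz hdr, series_eq_incl ξ hχ',
      genG_series h hχq hχz, genG_scaled h, act_mul]
  · have := recursion_of_chiRec hd hcr
    simpa only [hχ'] using this
  -- By the operator identity the matrix of `𝒢(ξ')` is `ℱ(λξ)`, so both satisfy the same initial
  -- value problem.
  · rw [genGMat_eq hG]
    exact solvesODE_genF h ξ
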